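/- Let $N$ be a natural number and write $\mathbb{R}_+^N=\{x\in\mathbb{R}^N: x_i\ge 0 \text{ for all } i\}$. For $x\in\mathbb{R}_+^N$ let $\Lambda(x)=\{i: x_i>0\}$, and for $\Lambda\subset\{1,\dots,N\}$ let $B_\Lambda=\{x\in\mathbb{R}_+^N:\Lambda(x)=\Lambda\}$. Let $(X(t))_{t\ge0}$ be a time-homogeneous Markov process, with right-continuous sample paths having left limits, on a state space $E\subset\mathbb{R}_+^N$. For $n\ge1$ let $Z_n(t)=X(nt)/n$ be the rescaled process on $\mathcal{E}_n=\frac1nE$, and let $\mathbb{P}_z$ be its law when $Z_n(0)=z\in\mathcal{E}_n$ (that is, $X(0)=nz$). Assume that for every $x\in\mathbb{R}_+^N$ there are $x_n\in\mathcal{E}_n$ with $x_n\to x$. For $T>0$ and $\phi:[0,T]\to\mathbb{R}_+^N$ put, with $\|\cdot\|_\infty$ the supremum norm on $[0,T]$ and $z$ ranging over $\mathcal{E}_n$, $$w_{[0,T]}(\phi)=\lim_{\delta\to0}\lim_{\varepsilon\to0}\liminf_{n\to\infty}\inf_{z:|z-\phi(0)|<\varepsilon}\frac1n\log\mathbb{P}_z(\|\phi-Z_n\|_\infty<\delta),$$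 $$W_{[0,T]}(\phi)=\lim_{\delta\to0}\limsup_{n\to\infty}\sup_{z:|z-\phi(0)|<\delta}\frac1n\log\mathbb{P}_z(\|\phi-Z_n\|_\infty<\delta).$$ Let $L_\Lambda:\mathbb{R}^N\to[0,+\infty]$, $\Lambda\subset\{1,\dots,N\}$, be convex functions such that: (A$_1$) for every $\Lambda$, every $T>0$ and every path $\phi:[0,T]\to\mathbb{R}_+^N$ of constant velocity $v$ with $\phi(t)\in B_\Lambda$ for $0<t<T$, one has $w_{[0,T]}(\phi)\ge -T L_\Lambda(v)$; (A$_2$) $L_{\{1,\dots,N\}}$ is finite in a neighborhood of zero; (A$_3$) for every $\Lambda$, every $T>0$ and all $x,y\in B_\Lambda$, $$\lim_{\delta\to0}\limsup_{n\to\infty}\sup_{z:|z-x|<\delta}\frac1n\log\mathbb{P}_z\bigl(|Z_n(T)-y|<\delta\text{ and }\tau_{\Lambda,n}>T\bigr)\le -T L_\Lambda\Bigl(\frac{y-x}{T}\Bigr),$$ where $\tau_{\Lambda,n}$ is the hitting time of $\bigcup_{i\in\Lambda}\{x:x_i=0\}$ by $Z_n$. Let $L(x,v)=L_{\Lambda(x)}(v)$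 and define $$I_{[0,T]}(\phi)=\lim_{\delta\to0}\ \inf_{\psi}\int_0^T L(\psi(t),\dot\psi(t))\,dt,$$ the infimum being over all continuous piecewise linear $\psi:[0,T]\to\mathbb{R}_+^N$ with $d_S(\phi,\psi)<\delta$, where $d_S$ is the Skorohod metric on $[0,T]$. Then for every $T>0$ and every absolutely continuous $\phi:[0,T]\to\mathbb{R}_+^N$, $$I_{[0,T]}(\phi)=\int_0^T L(\phi(t),\dot\phi(t))\,dt=-W_{[0,T]}(\phi)=-w_{[0,T]}(\phi),$$ as an equality in $[0,+\infty]$. -/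

import Mathlib

open MeasureTheory ProbabilityTheory Filter Topology Set
open scoped NNReal ENNReal

noncomputable section

namespace LocalLD

/-- The space `ℝ^N` with its Euclidean norm. -/
abbrev Vec (N : ℕ) : Type := EuclideanSpace ℝ (Fin N)

/-- The closed orthant `ℝ_+^N`. -/
def orthant (N : ℕ) : Set (Vec N) := {x | ∀ i, 0 ≤ x i}

/-- The set `Λ(x)` of the indices of the positive coordinates of `x`. -/
def posSet {N : ℕ} (x : Vec N) : Set (Fin N) := {i | 0 < x i}

/-- The face `B_Λ` of the orthant. -/
def face {N : ℕ} (Λ : Set (Fin N)) : Set (Vec N) := {x | x ∈ orthant N ∧ posSet x = Λ}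

/-- A time-homogeneous continuous-time Markov process with values in a set `E ⊆ ℝ_+^N`, given by
its transition kernels and by its laws `P x` for all the initial states `x ∈ E`; the sample paths
are right-continuous with left limits. -/
structure MarkovFamily (N : ℕ) (Ω : Type*) [MeasurableSpace Ω] where
  /-- the state space -/
  E : Set (Vec N)
  E_subset : E ⊆ orthant N
  /-- the process -/
  X : ℝ≥0 → Ω → E
  measurable_X : ∀ t, Measurable (X t)
  right_continuous : ∀ ω t, ContinuousWithinAt (fun s => (X s ω : Vec N)) (Ici t) t
  left_limits : ∀ ω t, ∃ l, Tendsto (fun s => (X s ω : Vec N)) (𝓝[<] t) (𝓝 l)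
  /-- the transition kernels -/
  p : ℝ≥0 → Kernel E E
  markov_p : ∀ t, IsMarkovKernel (p t)
  /-- the law of the process started at `x` -/
  P : E → Measure Ω
  isProbabilityMeasure_P : ∀ x, IsProbabilityMeasure (P x)
  initial_state : ∀ x, ∀ᵐ ω ∂(P x), X 0 ω = x
  /-- `P_x(X_{s+t} ∈ A | X_u, u ≤ s) = p_t(X_s, A)` -/
  markov_property : ∀ (x : E) (s t : ℝ≥0) (A : Set E), MeasurableSet A →
    ∀ B : Set Ω,
      MeasurableSet[⨆ u : ℝ≥0, ⨆ _ : u ≤ s,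
        MeasurableSpace.comap (X u) inferInstance] B →
      P x (B ∩ X (s + t) ⁻¹' A) = ∫⁻ ω in B, p t (X s ω) A ∂(P x)

namespace MarkovFamily

variable {N : ℕ} {Ω : Type*} [MeasurableSpace Ω] (M : MarkovFamily N Ω)

/-- The rescaled process `Z_n(t) = X(nt)/n`. Its state space is `E_n = E/n`, and the law of `Z_n`
started at `z = y/n` is the law `P y`, where `y ∈ E`. -/
def Z (n : ℕ) (t : ℝ≥0) (ω : Ω) : Vec N := (n : ℝ)⁻¹ • (M.X (n * t) ω : Vec N)

/-- Every point of `ℝ_+^N` is the limit of a sequence of points `x_n ∈ E_n = E/n`. -/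
def DenseStates : Prop :=
  ∀ x ∈ orthant N, ∃ y : ℕ → M.E, Tendsto (fun n : ℕ => (n : ℝ)⁻¹ • (y n : Vec N)) atTop (𝓝 x)

/-- `lim_{δ → 0} lim_{ε → 0} liminf_n inf_{z ∈ E_n, |z - x| < ε} (1/n) log P_z(A δ n)`, for events
`A δ n` that increase with `δ`. The states `z ∈ E_n` are written `z = y/n` with `y ∈ E`; the
expression is nonincreasing in `ε` and nondecreasing in `δ`, so that the limits are a supremum and
an infimum. -/
def lowerExponent (x : Vec N) (A : ℝ → ℕ → Set Ω) : EReal :=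
  ⨅ (δ : ℝ) (_ : 0 < δ), ⨆ (ε : ℝ) (_ : 0 < ε), liminf (fun n : ℕ =>
    ⨅ (y : M.E) (_ : ‖(n : ℝ)⁻¹ • (y : Vec N) - x‖ < ε), ENNReal.log (M.P y (A δ n)) / n) atTop

/-- `lim_{δ → 0} limsup_n sup_{z ∈ E_n, |z - x| < δ} (1/n) log P_z(A δ n)`, for events `A δ n` that
increase with `δ`; the expression is nondecreasing in `δ`, so that the limit is an infimum. -/
def upperExponent (x : Vec N) (A : ℝ → ℕ → Set Ω) : EReal :=
  ⨅ (δ : ℝ) (_ : 0 < δ), limsup (fun n : ℕ =>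
    ⨆ (y : M.E) (_ : ‖(n : ℝ)⁻¹ • (y : Vec N) - x‖ < δ), ENNReal.log (M.P y (A δ n)) / n) atTop

/-- The event `‖φ - Z_n‖_∞ < δ`, where `‖·‖_∞` is the supremum norm on `[0, T]`. -/
def tube (T : ℝ) (φ : ℝ → Vec N) (δ : ℝ) (n : ℕ) : Set Ω :=
  {ω | (⨆ (t : ℝ≥0) (_ : (t : ℝ) ≤ T), edist (φ t) (M.Z n t ω)) < ENNReal.ofReal δ}

/-- The lower local large-deviation exponent `w_{[0,T]}(φ)`. -/
def w (T : ℝ) (φ : ℝ → Vec N) : EReal := M.lowerExponent (φ 0) (M.tube T φ)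

/-- The upper local large-deviation exponent `W_{[0,T]}(φ)`. -/
def W (T : ℝ) (φ : ℝ → Vec N) : EReal := M.upperExponent (φ 0) (M.tube T φ)

/-- The hitting time `τ_{Λ,n}` of `⋃_{i ∈ Λ} {x : x_i = 0}` by `Z_n` (infinite if there is no
hit). -/
def τ (Λ : Set (Fin N)) (n : ℕ) : Ω → WithTop ℝ≥0 :=
  hittingAfter (M.Z n) (⋃ i ∈ Λ, {x : Vec N | x i = 0}) 0

/-- The event `|Z_n(T) - y| < δ` and `τ_{Λ,n} > T`. -/
def endEvent (Λ : Set (Fin N)) (T : ℝ) (y : Vec N) (δ : ℝ) (n : ℕ) : Set Ω :=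
  {ω | ‖M.Z n T.toNNReal ω - y‖ < δ ∧ (T.toNNReal : WithTop ℝ≥0) < M.τ Λ n ω}

/-- The local lower bounds for the linear paths `x + t v`, `0 ≤ t ≤ T`, inside a face. -/
def A1 (L : Set (Fin N) → Vec N → ℝ≥0∞) : Prop :=
  ∀ (Λ : Set (Fin N)) (T : ℝ), 0 < T → ∀ x v : Vec N,
    (∀ t ∈ Icc 0 T, x + t • v ∈ orthant N) → (∀ t ∈ Ioo 0 T, x + t • v ∈ face Λ) →
    -((ENNReal.ofReal T * L Λ v : ℝ≥0∞) : EReal) ≤ M.w T (fun t => x + t • v)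

/-- The local upper bounds up to the hitting time of the faces. -/
def A3 (L : Set (Fin N) → Vec N → ℝ≥0∞) : Prop :=
  ∀ (Λ : Set (Fin N)) (T : ℝ), 0 < T → ∀ x ∈ face Λ, ∀ y ∈ face Λ,
    M.upperExponent x (M.endEvent Λ T y) ≤
      -((ENNReal.ofReal T * L Λ (T⁻¹ • (y - x)) : ℝ≥0∞) : EReal)

end MarkovFamily

/-- `L_{1,…,N}` is finite in a neighbourhood of zero. -/
def A2 {N : ℕ} (L : Set (Fin N) → Vec N → ℝ≥0∞) : Prop := ∀ᶠ v in 𝓝 (0 : Vec N), L univ v < ⊤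

/-- `∫_0^T L(φ(t), φ'(t)) dt` with `L(x, v) = L_{Λ(x)}(v)`. -/
def action {N : ℕ} (L : Set (Fin N) → Vec N → ℝ≥0∞) (T : ℝ) (φ : ℝ → Vec N) : ℝ≥0∞ :=
  ∫⁻ t in Icc 0 T, L (posSet (φ t)) (deriv φ t)

/-- The restriction of `ψ` to `[0, T]` is a continuous piecewise linear path in `ℝ_+^N`. -/
def IsPiecewiseLinear {N : ℕ} (T : ℝ) (ψ : ℝ → Vec N) : Prop :=
  (∀ t ∈ Icc 0 T, ψ t ∈ orthant N) ∧
  ∃ (n : ℕ) (s : ℕ → ℝ), Monotone s ∧ s 0 = 0 ∧ s n = T ∧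
    ∀ i < n, ∀ t ∈ Icc (s i) (s (i + 1)),
      ψ t = ψ (s i) + ((t - s i) / (s (i + 1) - s i)) • (ψ (s (i + 1)) - ψ (s i))

/-- The Skorohod (J1) distance of the restrictions of `φ` and `ψ` to `[0, T]`; the infimum is over
the increasing bijections of `[0, T]`. -/
def skorohodDist {N : ℕ} (T : ℝ) (φ ψ : ℝ → Vec N) : ℝ≥0∞ :=
  ⨅ r : Icc (0 : ℝ) T ≃o Icc (0 : ℝ) T,
    max (⨆ t, edist (r t) t) (⨆ t : Icc (0 : ℝ) T, edist (φ t) (ψ (r t)))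

/-- The regularization `I_{[0,T]}` of the functional `J_{[0,T]} = action L T` on the continuous
piecewise linear paths: the limit as `δ → 0` of the infimum of `J` over the `ψ` with
`d_S(φ, ψ) < δ`. The infimum is nonincreasing in `δ`, so that the limit is a supremum. -/
def rateI {N : ℕ} (L : Set (Fin N) → Vec N → ℝ≥0∞) (T : ℝ) (φ : ℝ → Vec N) : ℝ≥0∞ :=
  ⨆ (δ : ℝ) (_ : 0 < δ), ⨅ (ψ : ℝ → Vec N)
    (_ : IsPiecewiseLinear T ψ ∧ skorohodDist T φ ψ < ENNReal.ofReal δ), action L T ψ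

end LocalLD

end

noncomputable section

namespace LocalLD

/-! ### Exponential rates and the Markov property -/

section

/-! Write J for `action L T φ` and I for `rateI L T φ`. The theorem follows from the cycle -I ≤ w ≤
W ≤ -J together with I ≤ J. The middle inequality is immediate once there are states close to φ(0).

-I ≤ w (`neg_rateI_le_w`). The interior of a linear segment lies in one face, so (A₁) and the Markov
property give the lower bound for piecewise linear paths (`PLPath.lowerRate`). If ψ is close to φ,
then ψ(0) is only close to φ(0). By (A₂) the two points can be joined through the interior of the
orthant, with time and cost proportional to their distance (`exists_connectingConst`). The joined
path still lies in the tube around φ.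

W ≤ -J (`W_le_neg_action`). Call a time δ-regular if every positive coordinate of φ is then at least
δ. In a cell of a fine partition all regular times belong to one face, and between the first and the
last of them φ stays away from the walls of that face. There (A₃) bounds the probability by the cost
of a difference quotient, and the rest of the cell is given rate zero. As the mesh shrinks, Fatou's
lemma yields J restricted to the regular times (`tubeUpperRate_regularTimes`), and δ → 0 recovers J.

I ≤ J (`rateI_le_action`). In each cell φ is replaced by one segment that carries the displacement
accumulated during the regular times, with two short connections to the ends of the cell. Jensen's
inequality bounds the cost of the segment. The connections are paid for by the integral of 1 + |φ'|
over the irregular times, which tends to zero with δ.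

Nothing is assumed on how the costs of different faces compare. Playing (A₁) against (A₃) on nested
tubes shows that they are lower semicontinuous jointly in the face and the tangent velocity
(`exists_le_cost`). This gives measurability, Jensen's inequality, the Fatou step and L_Λ(0) ≤
L_{1,…,N}(0). -/

theorem log_div_natCast_le_iff {p : ℝ≥0∞} {n : ℕ} (hn : 0 < n) (c : ℝ) :
    ENNReal.log p / n ≤ ((-c : ℝ) : EReal) ↔ p ≤ ENNReal.ofReal (Real.exp (-(n * c))) := by
  have h0 : (0 : EReal) < n := by exact_mod_cast hn
  rw [EReal.div_le_iff_le_mul h0 (EReal.natCast_ne_top n), ← EReal.exp_coe,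
    ← EReal.exp_le_exp_iff, ENNReal.exp_log]
  congr! 2
  push_cast
  simp

theorem le_log_div_natCast_iff {p : ℝ≥0∞} {n : ℕ} (hn : 0 < n) (c : ℝ) :
    ((-c : ℝ) : EReal) ≤ ENNReal.log p / n ↔ ENNReal.ofReal (Real.exp (-(n * c))) ≤ p := by
  have h0 : (0 : EReal) < n := by exact_mod_cast hn
  rw [EReal.le_div_iff_mul_le h0 (EReal.natCast_ne_top n), ← EReal.exp_coe,
    ← EReal.exp_le_exp_iff, ENNReal.exp_log]
  congr! 2
  push_cast
  simp [mul_comm]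

namespace MarkovFamily

variable {N : ℕ} {Ω : Type*} [MeasurableSpace Ω] (M : MarkovFamily N Ω)

instance (t : ℝ≥0) : IsMarkovKernel (M.p t) := M.markov_p t

instance (x : M.E) : IsProbabilityMeasure (M.P x) := M.isProbabilityMeasure_P x

/-- An exponential upper bound with rate `c` for events started close to `x`. -/
def UpperRate (x : Vec N) (A : ℝ → ℕ → Set Ω) (c : ℝ) : Prop :=
  ∃ δ : ℝ, 0 < δ ∧ ∀ᶠ n : ℕ in atTop, ∀ y : M.E, ‖(n : ℝ)⁻¹ • (y : Vec N) - x‖ < δ →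
    M.P y (A δ n) ≤ ENNReal.ofReal (Real.exp (-(n * c)))

/-- An exponential lower bound with rate `c` for events started close to `x`. -/
def LowerRate (x : Vec N) (A : ℝ → ℕ → Set Ω) (c : ℝ) : Prop :=
  ∀ δ : ℝ, 0 < δ → ∃ ε : ℝ, 0 < ε ∧ ∀ᶠ n : ℕ in atTop,
    ∀ y : M.E, ‖(n : ℝ)⁻¹ • (y : Vec N) - x‖ < ε →
      ENNReal.ofReal (Real.exp (-(n * c))) ≤ M.P y (A δ n)

variable {M}

theorem UpperRate.upperExponent_le {x : Vec N} {A : ℝ → ℕ → Set Ω} {c : ℝ}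
    (h : M.UpperRate x A c) : M.upperExponent x A ≤ ((-c : ℝ) : EReal) := by
  obtain ⟨δ, hδ, h⟩ := h
  refine (iInf₂_le δ hδ).trans (limsup_le_of_le (by isBoundedDefault) ?_)
  filter_upwards [h, eventually_gt_atTop 0] with n hn h0
  exact iSup₂_le fun y hy => (log_div_natCast_le_iff h0 c).2 (hn y hy)

theorem upperRate_of_lt {x : Vec N} {A : ℝ → ℕ → Set Ω} {c : ℝ}
    (h : M.upperExponent x A < ((-c : ℝ) : EReal)) : M.UpperRate x A c := by
  simp only [upperExponent, iInf_lt_iff] at h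
  obtain ⟨δ, hδ, h⟩ := h
  refine ⟨δ, hδ, ?_⟩
  filter_upwards [eventually_lt_of_limsup_lt h, eventually_gt_atTop 0] with n hn h0 y hy
  exact (log_div_natCast_le_iff h0 c).1 ((le_iSup₂ (f := fun (y : M.E)
    (_ : ‖(n : ℝ)⁻¹ • (y : Vec N) - x‖ < δ) => ENNReal.log (M.P y (A δ n)) / (n : EReal))
    y hy).trans hn.le)

theorem LowerRate.le_lowerExponent {x : Vec N} {A : ℝ → ℕ → Set Ω} {c : ℝ}
    (h : M.LowerRate x A c) : ((-c : ℝ) : EReal) ≤ M.lowerExponent x A := by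
  refine le_iInf₂ fun δ hδ => ?_
  obtain ⟨ε, hε, h⟩ := h δ hδ
  refine le_trans ?_ (le_iSup₂ (f := fun (ε : ℝ) (_ : 0 < ε) => liminf (fun n : ℕ =>
    ⨅ (y : M.E) (_ : ‖(n : ℝ)⁻¹ • (y : Vec N) - x‖ < ε), ENNReal.log (M.P y (A δ n)) / (n : EReal))
    atTop) ε hε)
  refine le_liminf_of_le (by isBoundedDefault) ?_
  filter_upwards [h, eventually_gt_atTop 0] with n hn h0
  exact le_iInf₂ fun y hy => (le_log_div_natCast_iff h0 c).2 (hn y hy)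

theorem lowerRate_of_lt {x : Vec N} {A : ℝ → ℕ → Set Ω} {c : ℝ}
    (h : ((-c : ℝ) : EReal) < M.lowerExponent x A) : M.LowerRate x A c := by
  intro δ hδ
  have h1 := h.trans_le (iInf₂_le δ hδ)
  simp only [lt_iSup_iff] at h1
  obtain ⟨ε, hε, h1⟩ := h1
  refine ⟨ε, hε, ?_⟩
  filter_upwards [eventually_lt_of_lt_liminf h1, eventually_gt_atTop 0] with n hn h0 y hy
  exact (le_log_div_natCast_iff h0 c).1 (hn.le.trans (iInf₂_le (f := fun (y : M.E)
    (_ : ‖(n : ℝ)⁻¹ • (y : Vec N) - x‖ < ε) => ENNReal.log (M.P y (A δ n)) / (n : EReal)) y hy))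

theorem LowerRate.mono {x : Vec N} {A : ℝ → ℕ → Set Ω} {c c' : ℝ}
    (h : M.LowerRate x A c) (hc : c ≤ c') : M.LowerRate x A c' := by
  intro δ hδ
  obtain ⟨ε, hε, h⟩ := h δ hδ
  refine ⟨ε, hε, h.mono fun n hn y hy => le_trans ?_ (hn y hy)⟩
  gcongr

theorem upperRate_zero (x : Vec N) (A : ℝ → ℕ → Set Ω) : M.UpperRate x A 0 :=
  ⟨1, one_pos, Eventually.of_forall fun n y _ => by simpa using prob_le_one⟩

/-- Testing finite rates also covers `C = ⊤`. When `C = 0` there is no such rate, and the trivial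
bound by probability one takes over. -/
theorem upperExponent_le_neg {x : Vec N} {A : ℝ → ℕ → Set Ω} {C : ℝ≥0∞}
    (h : ∀ c : ℝ≥0, (c : ℝ≥0∞) < C → M.UpperRate x A c) :
    M.upperExponent x A ≤ -(C : EReal) := by
  rw [← EReal.neg_le_neg_iff, neg_neg]
  have key : ∀ c : ℝ, M.UpperRate x A c → (c : EReal) ≤ -M.upperExponent x A := fun c hc => by
    have := hc.upperExponent_le
    rw [← EReal.neg_le_neg_iff] at this
    simpa using this
  refine le_of_forall_lt fun a ha => ?_
  rcases lt_or_ge a 0 with h0 | h0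
  · exact h0.trans_le (by simpa using key 0 (upperRate_zero x A))
  · obtain ⟨r, har, hr⟩ := EReal.lt_iff_exists_real_btwn.1 ha
    have hr0 : 0 ≤ r := by exact_mod_cast h0.trans har.le
    lift r to ℝ≥0 using hr0
    rw [← EReal.coe_nnreal_eq_coe_real] at hr
    exact har.trans_le (key r (h r (by exact_mod_cast hr)))

theorem le_lowerExponent_neg {x : Vec N} {A : ℝ → ℕ → Set Ω} {C : ℝ≥0∞}
    (h : ∀ c : ℝ≥0, C < c → M.LowerRate x A c) :
    -(C : EReal) ≤ M.lowerExponent x A := by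
  rw [← EReal.neg_le_neg_iff, neg_neg]
  refine le_of_forall_gt fun a ha => ?_
  obtain ⟨r, hr, hra⟩ := EReal.lt_iff_exists_real_btwn.1 ha
  have hr0 : 0 ≤ r := by exact_mod_cast (EReal.coe_ennreal_nonneg C).trans hr.le
  lift r to ℝ≥0 using hr0
  refine lt_of_le_of_lt ?_ hra
  rw [← EReal.coe_nnreal_eq_coe_real] at hr
  have := (h r (by exact_mod_cast hr)).le_lowerExponent
  rw [← EReal.neg_le_neg_iff] at this
  simpa using this

variable (M)

/-- The information on the process up to time `s`. -/
abbrev past (s : ℝ≥0) : MeasurableSpace Ω :=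
  ⨆ u : ℝ≥0, ⨆ _ : u ≤ s, MeasurableSpace.comap (M.X u) inferInstance

variable {M}

theorem past_le (s : ℝ≥0) : M.past s ≤ ‹MeasurableSpace Ω› :=
  iSup₂_le fun u _ => (M.measurable_X u).comap_le

theorem measurableSet_past {s u : ℝ≥0} (hu : u ≤ s) {A : Set M.E} (hA : MeasurableSet A) :
    MeasurableSet[M.past s] (M.X u ⁻¹' A) := by
  refine (le_iSup₂ (f := fun (u : ℝ≥0) (_ : u ≤ s) =>
    MeasurableSpace.comap (M.X u) inferInstance) u hu) _ ⟨A, hA, rfl⟩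

theorem past_mono {s t : ℝ≥0} (h : s ≤ t) : M.past s ≤ M.past t :=
  iSup₂_le fun u hu => le_iSup₂ (f := fun (u : ℝ≥0) (_ : u ≤ t) =>
    MeasurableSpace.comap (M.X u) inferInstance) u (hu.trans h)

/-- On sets `A` this is the Markov property, read as an identity between two measures on the state
space; integrating `f` against both gives the claim. -/
theorem lintegral_markov (x : M.E) (s t : ℝ≥0) {B : Set Ω} (hB : MeasurableSet[M.past s] B)
    {f : M.E → ℝ≥0∞} (hf : Measurable f) :
    ∫⁻ ω in B, f (M.X (s + t) ω) ∂(M.P x) =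
      ∫⁻ ω in B, ∫⁻ z, f z ∂(M.p t (M.X s ω)) ∂(M.P x) := by
  have hB' := past_le s B hB
  have key : ((M.P x).restrict B).map (M.X (s + t)) =
      (((M.P x).restrict B).map (M.X s)).bind (M.p t) := by
    ext A hA
    rw [Measure.map_apply (M.measurable_X _) hA, Measure.restrict_apply (M.measurable_X _ hA),
      Measure.bind_apply hA (M.p t).measurable.aemeasurable,
      lintegral_map ((M.p t).measurable_coe hA) (M.measurable_X s), inter_comm]
    exact M.markov_property x s t A hA B hB
  rw [← lintegral_map hf (M.measurable_X _), key,
    Measure.lintegral_bind (M.p t).measurable.aemeasurable hf.aemeasurable,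
    lintegral_map hf.lintegral_kernel (M.measurable_X s)]

/-- The earliest time is peeled off: the later constraints are already a function of the state at
that time, and the kernel averages it. The same `g` serves all `x`, `s` and `B`, which is time
homogeneity and later identifies `g` with a probability under `P y`. -/
theorem exists_finite_cylinder (A : ℝ≥0 → Set M.E) (hA : ∀ u, MeasurableSet (A u))
    (F : Finset ℝ≥0) : ∀ a : ℝ≥0, (∀ u ∈ F, a ≤ u) → ∃ g : M.E → ℝ≥0∞, Measurable g ∧
      ∀ (x : M.E) (s : ℝ≥0) (B : Set Ω), MeasurableSet[M.past (s + a)] B →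
        M.P x (B ∩ {ω | ∀ u ∈ F, M.X (s + u) ω ∈ A u}) = ∫⁻ ω in B, g (M.X (s + a) ω) ∂(M.P x) := by
  induction F using Finset.induction_on_min with
  | empty => exact fun a _ => ⟨fun _ => 1, measurable_const, fun x s B _ => by simp⟩
  | insert b F hb ih =>
    intro a ha
    obtain ⟨g, hg, h⟩ := ih b fun u hu => (hb u hu).le
    have hab : a ≤ b := ha b (Finset.mem_insert_self _ _)
    refine ⟨fun z => ∫⁻ y, (A b).indicator g y ∂(M.p (b - a) z),
      (hg.indicator (hA b)).lintegral_kernel, fun x s B hB => ?_⟩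
    have hB2 : MeasurableSet[M.past (s + b)] (B ∩ M.X (s + b) ⁻¹' A b) :=
      (past_mono (by gcongr) B hB).inter (measurableSet_past le_rfl (hA b))
    have hset : B ∩ {ω | ∀ u ∈ insert b F, M.X (s + u) ω ∈ A u} =
        (B ∩ M.X (s + b) ⁻¹' A b) ∩ {ω | ∀ u ∈ F, M.X (s + u) ω ∈ A u} := by
      ext ω
      simp [and_assoc]
    have hsb : s + b = s + a + (b - a) := by rw [add_assoc, add_tsub_cancel_of_le hab]
    rw [hset, h x s _ hB2, ← lintegral_markov x (s + a) (b - a) hB (hg.indicator (hA b)), ← hsb,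
      inter_comm, ← setLIntegral_indicator (M.measurable_X _ (hA b))]
    rfl

theorem measure_inter_initial (x : M.E) (C : Set Ω) {g : M.E → ℝ≥0∞}
    (h : M.P x (univ ∩ C) = ∫⁻ ω in univ, g (M.X 0 ω) ∂(M.P x)) : M.P x C = g x := by
  rw [univ_inter, Measure.restrict_univ] at h
  rw [h, lintegral_congr_ae ((M.initial_state x).mono fun ω hω => by rw [hω])]
  simp

/-- The Markov property in terms of the laws `P y` rather than the kernels. Countably many
constraints are a decreasing limit of finitely many, and both sides pass to the limit. -/
theorem markov_cylinder (A : ℝ≥0 → Set M.E) (hA : ∀ u, MeasurableSet (A u)) (D : ℕ → ℝ≥0)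
    (x : M.E) (s : ℝ≥0) (B : Set Ω) (hB : MeasurableSet[M.past s] B) :
    M.P x (B ∩ {ω | ∀ k, M.X (s + D k) ω ∈ A (D k)}) =
      ∫⁻ ω in B, M.P (M.X s ω) {ω | ∀ k, M.X (D k) ω ∈ A (D k)} ∂(M.P x) := by
  choose g hg h using fun m : ℕ => exists_finite_cylinder A hA ((Finset.range m).image D) 0
    (fun _ _ => zero_le)
  have hgP : ∀ m y, g m y = M.P y {ω | ∀ u ∈ (Finset.range m).image D, M.X u ω ∈ A u} := by
    intro m y
    have := h m y 0 univ MeasurableSet.univ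
    simp only [zero_add] at this
    exact (measure_inter_initial y _ this).symm
  have hcap : ∀ s, {ω | ∀ k, M.X (s + D k) ω ∈ A (D k)} =
      ⋂ m, {ω | ∀ u ∈ (Finset.range m).image D, M.X (s + u) ω ∈ A u} := by
    intro s
    ext ω
    simp only [Finset.mem_image, Finset.mem_range, mem_iInter, mem_ofPred_eq]
    exact ⟨fun H m u ⟨k, _, hk⟩ => hk ▸ H k, fun H k => H (k + 1) _ ⟨k, by simp, rfl⟩⟩
  have hanti : ∀ s, Antitone fun m => {ω | ∀ u ∈ (Finset.range m).image D, M.X (s + u) ω ∈ A u} :=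
    fun s m m' hm ω hω u hu => hω u (Finset.image_subset_image (Finset.range_mono hm) hu)
  have hms : ∀ s m, MeasurableSet {ω | ∀ u ∈ (Finset.range m).image D, M.X (s + u) ω ∈ A u} := by
    intro s m
    simp only [ofPred_forall]
    exact Finset.measurableSet_biInter _ fun u _ => M.measurable_X _ (hA _)
  have hinf : ∀ y, M.P y {ω | ∀ k, M.X (D k) ω ∈ A (D k)} = ⨅ m, g m y := by
    intro y
    have h1 := hcap 0
    simp only [zero_add] at h1
    have h2 := hanti 0
    simp only [zero_add] at h2
    have h3 := hms 0
    simp only [zero_add] at h3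
    rw [h1, h2.measure_iInter (fun m => (h3 m).nullMeasurableSet) ⟨0, measure_ne_top _ _⟩]
    simp_rw [hgP]
  simp_rw [hinf]
  have hganti : Antitone g := by
    intro m m' hm y
    rw [hgP, hgP]
    have := hanti 0 hm
    simp only [zero_add] at this
    exact measure_mono this
  rw [lintegral_iInf (f := fun m ω => g m (M.X s ω)) (fun m => (hg m).comp (M.measurable_X s))
    (fun m m' hm ω => hganti hm _)]
  · rw [hcap s, inter_iInter, Antitone.measure_iInter]
    · refine iInf_congr fun m => ?_
      have := h m x s B (by rwa [add_zero])
      simpa using this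
    · exact fun m m' hm => inter_subset_inter_right _ (hanti s hm)
    · exact fun m => ((past_le s B hB).inter (hms s m)).nullMeasurableSet
    · exact ⟨0, measure_ne_top _ _⟩
  · refine ne_of_lt (lt_of_le_of_lt (lintegral_mono (g := fun _ => 1) fun ω => ?_) ?_)
    · rw [hgP]; exact prob_le_one
    · simp

end MarkovFamily

end

/-! ### Tube events and the addition of rates -/

section

namespace MarkovFamily

variable {N : ℕ} {Ω : Type*} [MeasurableSpace Ω] (M : MarkovFamily N Ω)

theorem continuousWithinAt_Z (n : ℕ) (ω : Ω) (t : ℝ≥0) :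
    ContinuousWithinAt (fun s => M.Z n s ω) (Ici t) t := by
  have h : ContinuousWithinAt (fun s => (M.X (n * s) ω : Vec N)) (Ici t) t := by
    refine (M.right_continuous ω (n * t)).comp (f := fun s : ℝ≥0 => (n : ℝ≥0) * s)
      (by fun_prop) fun s hs => ?_
    simp only [mem_Ici] at hs ⊢
    gcongr
  exact h.const_smul (n : ℝ)⁻¹

/-- The event that the rescaled process after time `s` stays up to time `T` in the closed tube of
radius `δ` around `φ`. -/
def closedTube (s : ℝ≥0) (T : ℝ) (φ : ℝ → Vec N) (δ : ℝ) (n : ℕ) : Set Ω :=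
  {ω | ∀ t : ℝ≥0, (t : ℝ) ≤ T → dist (φ t) (M.Z n (s + t) ω) ≤ δ}

variable {M}

theorem mem_tube_dist {T : ℝ} {φ : ℝ → Vec N} {δ : ℝ} {n : ℕ} {ω : Ω} (hω : ω ∈ M.tube T φ δ n)
    {t : ℝ≥0} (ht : (t : ℝ) ≤ T) : dist (φ t) (M.Z n t ω) < δ := by
  have h1 : edist (φ t) (M.Z n t ω) < ENNReal.ofReal δ :=
    lt_of_le_of_lt (le_iSup₂ (f := fun (t : ℝ≥0) (_ : (t : ℝ) ≤ T) => edist (φ t) (M.Z n t ω)) t ht)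
      hω
  rw [edist_dist] at h1
  exact (ENNReal.ofReal_lt_ofReal_iff_of_nonneg dist_nonneg).1 h1

theorem mem_tube_of_dist_le {T : ℝ} {φ : ℝ → Vec N} {δ δ' : ℝ} (hδ : 0 < δ) (h : δ' < δ) {n : ℕ}
    {ω : Ω} (hω : ∀ t : ℝ≥0, (t : ℝ) ≤ T → dist (φ t) (M.Z n t ω) ≤ δ') : ω ∈ M.tube T φ δ n := by
  refine lt_of_le_of_lt (b := ENNReal.ofReal δ') (iSup₂_le fun t ht => ?_)
    ((ENNReal.ofReal_lt_ofReal_iff hδ).2 h)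
  rw [edist_dist]
  exact ENNReal.ofReal_le_ofReal (hω t ht)

theorem tube_subset_closedTube {T : ℝ} {φ : ℝ → Vec N} {δ : ℝ} {n : ℕ} :
    M.tube T φ δ n ⊆ M.closedTube 0 T φ δ n := fun ω hω t ht => by
  rw [zero_add]; exact (mem_tube_dist hω ht).le

theorem closedTube_subset_tube {T : ℝ} {φ : ℝ → Vec N} {δ δ' : ℝ} (hδ : 0 < δ) (h : δ' < δ)
    {n : ℕ} : M.closedTube 0 T φ δ' n ⊆ M.tube T φ δ n := fun ω hω =>
  mem_tube_of_dist_le hδ h fun t ht => by simpa using hω t ht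

/-- Tubes around nearby paths, on possibly different time intervals. -/
theorem tube_subset_tube {S T : ℝ} (hT : T ≤ S) {φ ψ : ℝ → Vec N} {δ δ' η : ℝ} (hδ : 0 < δ)
    (h : δ' + η < δ) (hη : ∀ t ∈ Icc 0 T, dist (φ t) (ψ t) ≤ η) {n : ℕ} :
    M.tube S ψ δ' n ⊆ M.tube T φ δ n := fun ω hω =>
  mem_tube_of_dist_le hδ h fun t ht => by
    have h1 := mem_tube_dist hω (ht.trans hT)
    have h2 := hη t ⟨t.2, ht⟩
    linarith [dist_triangle (φ t) (ψ t) (M.Z n t ω)]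

theorem tube_congr {T : ℝ} {φ ψ : ℝ → Vec N} (h : EqOn φ ψ (Icc 0 T)) :
    M.tube T φ = M.tube T ψ := by
  ext δ n ω
  simp only [tube, mem_ofPred_eq]
  have : (⨆ (t : ℝ≥0) (_ : (t : ℝ) ≤ T), edist (φ t) (M.Z n t ω)) =
      ⨆ (t : ℝ≥0) (_ : (t : ℝ) ≤ T), edist (ψ t) (M.Z n t ω) :=
    iSup_congr fun t => iSup_congr fun ht => by rw [h (x := (t : ℝ)) ⟨t.2, ht⟩]
  rw [this]

/-- A sequence of times that is dense in `[0, T]` and contains `T`. -/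
def denseTimes (T : ℝ≥0) (k : ℕ) : ℝ≥0 := min (TopologicalSpace.denseSeq ℝ≥0 k) T

/-- A strict violation at a time before `T` persists on a right neighbourhood, by right continuity,
and is seen at a dense time. The time `T` has no right neighbourhood in the interval, so it must
itself belong to the sequence. -/
theorem mem_closedTube_iff {s T : ℝ≥0} {φ : ℝ → Vec N} (hφ : ContinuousOn φ (Icc 0 (T : ℝ)))
    {δ : ℝ} {n : ℕ} {ω : Ω} : ω ∈ M.closedTube s T φ δ n ↔
      ∀ k, dist (φ (denseTimes T k)) (M.Z n (s + denseTimes T k) ω) ≤ δ := by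
  refine ⟨fun h k => h _ (by exact_mod_cast min_le_right _ _), fun h t ht => ?_⟩
  have hdense := TopologicalSpace.denseRange_denseSeq ℝ≥0
  have ht' : t ≤ T := by exact_mod_cast ht
  rcases ht'.eq_or_lt with rfl | hlt
  · obtain ⟨k, hk⟩ := hdense.exists_mem_open (isOpen_Ioi (a := t)) ⟨t + 1, by simp⟩
    have := h k
    rwa [denseTimes, min_eq_right (le_of_lt hk)] at this
  · by_contra! hcon
    have hf : ContinuousWithinAt (fun u : ℝ≥0 => dist (φ u) (M.Z n (s + u) ω)) (Icc t T) t := by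
      refine Filter.Tendsto.dist (f := fun u : ℝ≥0 => φ u) (g := fun u : ℝ≥0 => M.Z n (s + u) ω)
        ?_ ?_
      · refine (hφ t ⟨t.2, ht⟩).comp (f := fun u : ℝ≥0 => (u : ℝ)) (by fun_prop) fun u hu => ?_
        exact ⟨u.2, by exact_mod_cast hu.2⟩
      · refine (M.continuousWithinAt_Z n ω (s + t)).comp (f := fun u : ℝ≥0 => s + u) (by fun_prop)
          fun u hu => ?_
        simp only [mem_Ici]
        gcongr
        exact hu.1
    have hev := hf.eventually (lt_mem_nhds hcon)
    rw [nhdsWithin_Icc_eq_nhdsGE hlt] at hev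
    obtain ⟨b, hb, hsub⟩ := (mem_nhdsGE_iff_exists_Ico_subset' hlt).1 hev
    obtain ⟨k, hk⟩ := hdense.exists_mem_open (isOpen_Ioo (a := t) (b := min b T))
      (nonempty_Ioo.2 (lt_min hb hlt))
    have h1 : denseTimes T k = TopologicalSpace.denseSeq ℝ≥0 k :=
      min_eq_left (hk.2.trans_le (min_le_right _ _)).le
    have h2 : δ < dist (φ (denseTimes T k)) (M.Z n (s + denseTimes T k) ω) :=
      hsub ⟨h1 ▸ hk.1.le, h1 ▸ hk.2.trans_le (min_le_left _ _)⟩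
    exact absurd (h k) (not_le.2 h2)

/-- The states whose rescaling is close to `φ` at the rescaled time. -/
def tubeStates (φ : ℝ → Vec N) (δ : ℝ) (n : ℕ) (u : ℝ≥0) : Set M.E :=
  {y | dist (φ ((u / n : ℝ≥0))) ((n : ℝ)⁻¹ • (y : Vec N)) ≤ δ}

theorem measurableSet_tubeStates (φ : ℝ → Vec N) (δ : ℝ) (n : ℕ) (u : ℝ≥0) :
    MeasurableSet (tubeStates (M := M) φ δ n u) := by
  refine measurableSet_le (Measurable.dist measurable_const ?_) measurable_const
  exact (measurable_subtype_coe (p := (· ∈ M.E))).const_smul (n : ℝ)⁻¹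

/-- Puts the tube in the form of a countable cylinder, to which `markov_cylinder` applies. -/
theorem closedTube_eq {s T : ℝ≥0} {φ : ℝ → Vec N} (hφ : ContinuousOn φ (Icc 0 (T : ℝ)))
    {δ : ℝ} {n : ℕ} (hn : 0 < n) : M.closedTube s T φ δ n =
      {ω | ∀ k, M.X (n * s + n * denseTimes T k) ω ∈ tubeStates φ δ n (n * denseTimes T k)} := by
  ext ω
  rw [mem_closedTube_iff hφ]
  have hn' : (n : ℝ≥0) ≠ 0 := by exact_mod_cast hn.ne'
  simp only [tubeStates, mem_ofPred_eq, mul_div_cancel_left₀ _ hn', Z, mul_add]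

theorem measurableSet_past_closedTube {T : ℝ≥0} {φ : ℝ → Vec N}
    (hφ : ContinuousOn φ (Icc 0 (T : ℝ))) {δ : ℝ} {n : ℕ} (hn : 0 < n) :
    MeasurableSet[M.past (n * T)] (M.closedTube 0 T φ δ n) := by
  rw [closedTube_eq hφ hn, ofPred_forall]
  refine @MeasurableSet.iInter _ _ (M.past (n * T)) _ _ fun k => ?_
  refine measurableSet_past ?_ (measurableSet_tubeStates _ _ _ _)
  rw [mul_zero, zero_add]
  gcongr
  exact min_le_right _ _

theorem markov_closedTube {s T : ℝ≥0} {φ : ℝ → Vec N} (hφ : ContinuousOn φ (Icc 0 (T : ℝ)))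
    {δ : ℝ} {n : ℕ} (hn : 0 < n) (x : M.E) {B : Set Ω} (hB : MeasurableSet[M.past (n * s)] B) :
    M.P x (B ∩ M.closedTube s T φ δ n) =
      ∫⁻ ω in B, M.P (M.X (n * s) ω) (M.closedTube 0 T φ δ n) ∂(M.P x) := by
  have := markov_cylinder (tubeStates (M := M) φ δ n) (measurableSet_tubeStates φ δ n)
    (fun k => n * denseTimes T k) x (n * s) B hB
  rw [closedTube_eq hφ hn, closedTube_eq hφ hn, this]
  simp

theorem closedTube_add {S T : ℝ≥0} {φ : ℝ → Vec N} {δ : ℝ} {n : ℕ} :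
    M.closedTube 0 (S + T : ℝ) φ δ n =
      M.closedTube 0 S φ δ n ∩ M.closedTube S T (fun t => φ (S + t)) δ n := by
  ext ω
  constructor
  · refine fun h => ⟨fun t ht => h t (by linarith [T.2]), fun t ht => ?_⟩
    have := h (S + t) (by push_cast; linarith)
    simpa using this
  · rintro ⟨h1, h2⟩ t ht
    rcases le_total (t : ℝ) S with h | h
    · exact h1 t h
    · obtain ⟨u, rfl⟩ : ∃ u, t = S + u := ⟨t - S, (add_tsub_cancel_of_le (by exact_mod_cast h)).symm⟩
      have := h2 u (by push_cast at ht; linarith)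
      simpa using this

/-- A path in the first tube arrives near `φ S`, hence in the ball of starting points of the second
estimate, which is uniform there. Halving the radius leaves room to pass between open and closed
tubes. -/
theorem UpperRate.add {S T : ℝ≥0} {φ : ℝ → Vec N} (hφ : ContinuousOn φ (Icc 0 (S + T : ℝ)))
    {c c' : ℝ} (h : M.UpperRate (φ 0) (M.tube S φ) c)
    (h' : M.UpperRate (φ S) (M.tube T fun t => φ (S + t)) c') :
    M.UpperRate (φ 0) (M.tube (S + T : ℝ) φ) (c + c') := by
  obtain ⟨δ, hδ, h⟩ := h
  obtain ⟨δ', hδ', h'⟩ := h'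
  have hS : ContinuousOn φ (Icc 0 (S : ℝ)) :=
    hφ.mono (Icc_subset_Icc_right (by linarith [T.2]))
  have hT : ContinuousOn (fun t => φ (S + t)) (Icc 0 (T : ℝ)) :=
    hφ.comp (by fun_prop) fun t ht => ⟨by linarith [S.2, ht.1], by linarith [ht.2]⟩
  have hm := lt_min hδ hδ'
  refine ⟨min δ δ' / 2, half_pos hm, ?_⟩
  filter_upwards [h, h', eventually_gt_atTop 0] with n hn hn' h0 y hy
  have hlt : min δ δ' / 2 < δ := (half_lt_self hm).trans_le (min_le_left _ _)
  have hlt' : min δ δ' / 2 < δ' := (half_lt_self hm).trans_le (min_le_right _ _)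
  refine (measure_mono tube_subset_closedTube).trans ?_
  rw [closedTube_add, markov_closedTube hT h0 y (measurableSet_past_closedTube hS h0)]
  have hBm := past_le _ _ (measurableSet_past_closedTube (M := M) (δ := min δ δ' / 2) hS h0)
  calc _ ≤ ∫⁻ ω in M.closedTube 0 S φ (min δ δ' / 2) n,
        ENNReal.ofReal (Real.exp (-(n * c'))) ∂(M.P y) := by
        refine setLIntegral_mono' hBm fun ω hω => ?_
        refine (measure_mono (closedTube_subset_tube hδ' hlt')).trans (hn' _ ?_)
        have := hω S le_rfl
        rw [zero_add, dist_comm, dist_eq_norm] at this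
        exact this.trans_lt hlt'
    _ = ENNReal.ofReal (Real.exp (-(n * c'))) * M.P y (M.closedTube 0 S φ (min δ δ' / 2) n) := by
        rw [setLIntegral_const]
    _ ≤ ENNReal.ofReal (Real.exp (-(n * c'))) * ENNReal.ofReal (Real.exp (-(n * c))) := by
        gcongr
        exact (measure_mono (closedTube_subset_tube hδ hlt)).trans (hn y (hy.trans hlt))
    _ = _ := by
        rw [← ENNReal.ofReal_mul (Real.exp_pos _).le, ← Real.exp_add]
        congr 2
        ring

/-- The radius of the first tube is chosen after `ε'`, so that every path in it arrives at an
admissible starting point for the second. -/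
theorem LowerRate.add {S T : ℝ≥0} {φ : ℝ → Vec N} (hφ : ContinuousOn φ (Icc 0 (S + T : ℝ)))
    {c c' : ℝ} (h : M.LowerRate (φ 0) (M.tube S φ) c)
    (h' : M.LowerRate (φ S) (M.tube T fun t => φ (S + t)) c') :
    M.LowerRate (φ 0) (M.tube (S + T : ℝ) φ) (c + c') := by
  intro δ hδ
  obtain ⟨ε', hε', h'⟩ := h' (δ / 2) (half_pos hδ)
  have hS : ContinuousOn φ (Icc 0 (S : ℝ)) :=
    hφ.mono (Icc_subset_Icc_right (by linarith [T.2]))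
  have hT : ContinuousOn (fun t => φ (S + t)) (Icc 0 (T : ℝ)) :=
    hφ.comp (by fun_prop) fun t ht => ⟨by linarith [S.2, ht.1], by linarith [ht.2]⟩
  have hm := lt_min (half_pos hδ) (half_pos hε')
  obtain ⟨ε, hε, h⟩ := h _ hm
  refine ⟨ε, hε, ?_⟩
  filter_upwards [h, h', eventually_gt_atTop 0] with n hn hn' h0 y hy
  refine le_trans ?_ (measure_mono (closedTube_subset_tube hδ (half_lt_self hδ)))
  rw [closedTube_add]
  set r := min (δ / 2) (ε' / 2) with hr
  have hBm := past_le _ _ (measurableSet_past_closedTube (M := M) (δ := r) hS h0)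
  have hsub : M.closedTube 0 S φ r n ⊆ M.closedTube 0 S φ (δ / 2) n :=
    fun ω hω t ht => (hω t ht).trans (min_le_left _ _)
  refine le_trans ?_ (measure_mono (inter_subset_inter_left _ hsub))
  rw [markov_closedTube hT h0 y (measurableSet_past_closedTube hS h0)]
  calc _ = ENNReal.ofReal (Real.exp (-(n * c'))) * ENNReal.ofReal (Real.exp (-(n * c))) := by
        rw [← ENNReal.ofReal_mul (Real.exp_pos _).le, ← Real.exp_add]
        congr 2
        ring
    _ ≤ ENNReal.ofReal (Real.exp (-(n * c'))) * M.P y (M.closedTube 0 S φ r n) := by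
        gcongr
        exact (hn y hy).trans (measure_mono tube_subset_closedTube)
    _ = ∫⁻ ω in M.closedTube 0 S φ r n, ENNReal.ofReal (Real.exp (-(n * c'))) ∂(M.P y) := by
        rw [setLIntegral_const]
    _ ≤ _ := by
        refine setLIntegral_mono' hBm fun ω hω => ?_
        refine (hn' _ ?_).trans (measure_mono tube_subset_closedTube)
        have := hω S le_rfl
        rw [zero_add, dist_comm, dist_eq_norm] at this
        exact this.trans_lt ((min_le_right _ _).trans_lt (half_lt_self hε'))

theorem lowerRate_tube_zero (φ : ℝ → Vec N) : M.LowerRate (φ 0) (M.tube 0 φ) 0 := by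
  intro δ hδ
  refine ⟨δ / 2, half_pos hδ, Eventually.of_forall fun n y hy => ?_⟩
  have : M.P y (M.tube 0 φ δ n) = 1 := by
    rw [measure_congr (eventuallyEq_univ.2 ?_), measure_univ]
    filter_upwards [M.initial_state y] with ω hω
    refine mem_tube_of_dist_le hδ (half_lt_self hδ) fun t ht => ?_
    obtain rfl : t = 0 := le_antisymm (by exact_mod_cast ht) zero_le
    rw [Z, mul_zero, hω, dist_comm, dist_eq_norm]
    exact hy.le
  rw [this]
  simp

/-- On the tube around a path that stays away from the faces `x_i = 0`, `i ∈ Λ`, these faces are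
not hit. -/
theorem tube_subset_endEvent {T : ℝ} (hT : 0 ≤ T) {φ : ℝ → Vec N} {Λ : Set (Fin N)} {δ : ℝ}
    (h : ∀ t ∈ Icc 0 T, ∀ i ∈ Λ, δ ≤ φ t i) (n : ℕ) :
    M.tube T φ δ n ⊆ M.endEvent Λ T (φ T) δ n := by
  intro ω hω
  have hpos : ∀ t : ℝ≥0, (t : ℝ) ≤ T → ∀ i ∈ Λ, 0 < M.Z n t ω i := by
    intro t ht i hi
    have h1 := mem_tube_dist hω ht
    rw [dist_eq_norm] at h1
    have h2 := PiLp.norm_apply_le (φ t - M.Z n t ω) i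
    rw [Real.norm_eq_abs, PiLp.sub_apply] at h2
    have h3 := h t ⟨t.2, ht⟩ i hi
    linarith [le_abs_self (φ t i - M.Z n t ω i)]
  refine ⟨?_, ?_⟩
  · have := mem_tube_dist hω (t := T.toNNReal) (by rw [Real.coe_toNNReal _ hT])
    rwa [Real.coe_toNNReal _ hT, dist_comm, dist_eq_norm] at this
  · simp only [τ, hittingAfter_def]
    split_ifs with hex
    · rw [WithTop.coe_lt_coe]
      -- The hitting time is an infimum, so exceeding `T` strictly requires a margin after `T`;
      -- right continuity provides it.
      have hev : ∀ᶠ s in 𝓝[≥] T.toNNReal, ∀ i ∈ Λ, 0 < M.Z n s ω i := by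
        rw [eventually_all_finite Λ.toFinite]
        intro i hi
        have hc : ContinuousWithinAt (fun s => M.Z n s ω i) (Ici T.toNNReal) T.toNNReal :=
          ((EuclideanSpace.proj (𝕜 := ℝ) i).continuous.continuousAt).comp_continuousWithinAt
            (M.continuousWithinAt_Z n ω T.toNNReal)
        exact hc.eventually (lt_mem_nhds (hpos _ (by rw [Real.coe_toNNReal _ hT]) i hi))
      obtain ⟨b, hb, hsub⟩ := (mem_nhdsGE_iff_exists_Ico_subset' (lt_add_one T.toNNReal)).1 hev
      refine lt_of_lt_of_le hb (le_csInf ?_ ?_)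
      · obtain ⟨j, hj⟩ := hex
        exact ⟨j, hj⟩
      · rintro s ⟨-, hs⟩
        by_contra! hlt
        simp only [mem_iUnion, mem_ofPred_eq] at hs
        obtain ⟨i, hi, hz⟩ := hs
        rcases le_total s T.toNNReal with hsT | hsT
        · exact (hpos s (by rwa [← Real.le_toNNReal_iff_coe_le hT]) i hi).ne' hz
        · exact (hsub ⟨hsT, hlt⟩ i hi).ne' hz
    · exact WithTop.coe_lt_top _

theorem exists_state_near (hdense : M.DenseStates) {x : Vec N} (hx : x ∈ orthant N) {ε : ℝ}
    (hε : 0 < ε) : ∀ᶠ n : ℕ in atTop, ∃ y : M.E, ‖(n : ℝ)⁻¹ • (y : Vec N) - x‖ < ε := by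
  obtain ⟨y, hy⟩ := hdense x hx
  filter_upwards [hy.eventually (Metric.ball_mem_nhds x hε)] with n hn
  exact ⟨y n, by rwa [← dist_eq_norm]⟩

/-- For large `n` some state is admissible for both estimates, and nested events force the order of
the rates. The centres `x` and `x'` may differ, as the comparison of neighbouring paths requires. -/
theorem LowerRate.le_upperRate (hdense : M.DenseStates) {x x' : Vec N} (hx : x ∈ orthant N)
    {A A' : ℝ → ℕ → Set Ω} {c c' : ℝ} (h : M.LowerRate x A c)
    {δ δ' : ℝ} (hδ' : 0 < δ') (hxx : dist x x' < δ)
    (h' : ∀ᶠ n : ℕ in atTop, ∀ y : M.E, ‖(n : ℝ)⁻¹ • (y : Vec N) - x'‖ < δ →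
      M.P y (A' δ n) ≤ ENNReal.ofReal (Real.exp (-(n * c'))))
    (hAA : ∀ n, A δ' n ⊆ A' δ n) : c' ≤ c := by
  obtain ⟨ε, hε, h⟩ := h δ' hδ'
  have hm : 0 < min ε (δ - dist x x') := lt_min hε (by linarith)
  obtain ⟨n, h1, h2, ⟨y, hy⟩, h0⟩ := (h.and (h'.and ((exists_state_near hdense hx hm).and
    (eventually_gt_atTop 0)))).exists
  have h3 := h1 y (hy.trans_le (min_le_left _ _))
  have h4 := h2 y (by
    rw [← dist_eq_norm] at hy ⊢
    linarith [dist_triangle ((n : ℝ)⁻¹ • (y : Vec N)) x x', hy.trans_le (min_le_right _ _)])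
  have h5 := h3.trans ((measure_mono (hAA n)).trans h4)
  rw [ENNReal.ofReal_le_ofReal_iff (Real.exp_pos _).le, Real.exp_le_exp, neg_le_neg_iff] at h5
  exact le_of_mul_le_mul_left h5 (by exact_mod_cast h0)

/-- Density of the states keeps the infimum in `w` from being taken over the empty set. -/
theorem w_le_W (hdense : M.DenseStates) {T : ℝ} {φ : ℝ → Vec N} (h0 : φ 0 ∈ orthant N) :
    M.w T φ ≤ M.W T φ := by
  refine le_iInf₂ fun δ hδ => (iInf₂_le δ hδ).trans (iSup₂_le fun ε hε => ?_)
  refine (liminf_le_liminf ?_).trans liminf_le_limsup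
  filter_upwards [exists_state_near hdense h0 (lt_min hε hδ)] with n ⟨y, hy⟩
  exact (iInf₂_le (f := fun (y : M.E) (_ : ‖(n : ℝ)⁻¹ • (y : Vec N) - φ 0‖ < ε) =>
    ENNReal.log (M.P y (M.tube T φ δ n)) / (n : EReal)) y (hy.trans_le (min_le_left _ _))).trans
    (le_iSup₂ (f := fun (y : M.E) (_ : ‖(n : ℝ)⁻¹ • (y : Vec N) - φ 0‖ < δ) =>
    ENNReal.log (M.P y (M.tube T φ δ n)) / (n : EReal)) y (hy.trans_le (min_le_right _ _)))

end MarkovFamily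

end

/-! ### The cost functions: semicontinuity, boundedness near zero, Jensen's inequality -/

section

variable {N : ℕ} {Ω : Type*} [MeasurableSpace Ω] {M : MarkovFamily N Ω}
  {L : Set (Fin N) → Vec N → ℝ≥0∞}

theorem MarkovFamily.A1.lowerRate (hA1 : M.A1 L) {Λ : Set (Fin N)} {T : ℝ} (hT : 0 < T)
    {x v : Vec N} (hx : ∀ t ∈ Icc 0 T, x + t • v ∈ orthant N)
    (hf : ∀ t ∈ Ioo 0 T, x + t • v ∈ face Λ) {c : ℝ≥0} (hc : ENNReal.ofReal T * L Λ v < c) :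
    M.LowerRate x (M.tube T fun t => x + t • v) c := by
  have h := hA1 Λ T hT x v hx hf
  rw [MarkovFamily.w] at h
  simp only [zero_smul, add_zero] at h
  refine MarkovFamily.lowerRate_of_lt (lt_of_lt_of_le ?_ h)
  rw [EReal.coe_neg, ← EReal.coe_nnreal_eq_coe_real, EReal.neg_lt_neg_iff]
  exact_mod_cast hc

theorem MarkovFamily.A3.upperRate (hA3 : M.A3 L) {Λ : Set (Fin N)} {T : ℝ} (hT : 0 < T)
    {x y : Vec N} (hx : x ∈ face Λ) (hy : y ∈ face Λ) {c : ℝ≥0}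
    (hc : c < ENNReal.ofReal T * L Λ (T⁻¹ • (y - x))) :
    M.UpperRate x (M.endEvent Λ T y) c := by
  refine MarkovFamily.upperRate_of_lt (lt_of_le_of_lt (hA3 Λ T hT x hx y hy) ?_)
  rw [EReal.coe_neg, ← EReal.coe_nnreal_eq_coe_real, EReal.neg_lt_neg_iff]
  exact_mod_cast hc

open Classical in
/-- The projection of `ℝ^N` to the coordinates in `Λ`. -/
def coordProj (Λ : Set (Fin N)) : Vec N →ₗ[ℝ] Vec N where
  toFun v := WithLp.toLp 2 fun i => if i ∈ Λ then v i else 0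
  map_add' v w := by ext i; by_cases h : i ∈ Λ <;> simp [h]
  map_smul' a v := by ext i; by_cases h : i ∈ Λ <;> simp [h]

theorem coordProj_of_mem {Λ : Set (Fin N)} {i : Fin N} (h : i ∈ Λ) (v : Vec N) :
    coordProj Λ v i = v i := by simp [coordProj, h]

theorem coordProj_of_notMem {Λ : Set (Fin N)} {i : Fin N} (h : i ∉ Λ) (v : Vec N) :
    coordProj Λ v i = 0 := by simp [coordProj, h]

theorem coordProj_eq_self {Λ : Set (Fin N)} {v : Vec N} (h : ∀ i ∉ Λ, v i = 0) :
    coordProj Λ v = v := by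
  ext i
  by_cases hi : i ∈ Λ
  · exact coordProj_of_mem hi v
  · rw [coordProj_of_notMem hi, h i hi]

/-- The vector all of whose coordinates are `1`. -/
def ones (N : ℕ) : Vec N := WithLp.toLp 2 fun _ => 1

@[simp] theorem ones_apply (i : Fin N) : ones N i = 1 := rfl

theorem mem_face_iff {Λ : Set (Fin N)} {x : Vec N} :
    x ∈ face Λ ↔ (∀ i ∈ Λ, 0 < x i) ∧ ∀ i ∉ Λ, x i = 0 := by
  constructor
  · rintro ⟨h, rfl⟩
    exact ⟨fun i hi => hi, fun i hi => le_antisymm (not_lt.1 hi) (h i)⟩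
  · rintro ⟨h, h'⟩
    refine ⟨fun i => ?_, ?_⟩
    · by_cases hi : i ∈ Λ
      · exact (h i hi).le
      · exact (h' i hi).ge
    · ext i
      by_cases hi : i ∈ Λ
      · simp [posSet, hi, h i hi]
      · simp [posSet, hi, h' i hi]

/-- The costs on the faces are jointly lower semicontinuous; in particular they increase with the
face. -/
theorem exists_le_cost (hdense : M.DenseStates) (hA1 : M.A1 L) (hA3 : M.A3 L)
    {Λ : Set (Fin N)} {v : Vec N} (hv : ∀ i ∉ Λ, v i = 0) {c : ℝ≥0} (hc : c < L Λ v) :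
    ∃ η : ℝ, 0 < η ∧ ∀ Λ', Λ ⊆ Λ' → ∀ v' : Vec N, (∀ i ∉ Λ', v' i = 0) → ‖v' - v‖ < η →
      c ≤ L Λ' v' := by
  have hvi : ∀ i, |v i| ≤ ‖v‖ := fun i => PiLp.norm_apply_le v i
  -- With this starting point the coordinates in `Λ` stay at least 2 during a unit time at velocity
  -- `v`.
  set x : Vec N := coordProj Λ ((‖v‖ + 2) • ones N) with hx
  have hxΛ : ∀ i ∈ Λ, x i = ‖v‖ + 2 := fun i hi => by simp [hx, coordProj_of_mem hi]
  have hxΛ' : ∀ i ∉ Λ, x i = 0 := fun i hi => by simp [hx, coordProj_of_notMem hi]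
  have hpath : ∀ t ∈ Icc (0 : ℝ) 1, ∀ i ∈ Λ, 2 ≤ (x + t • v) i := by
    intro t ht i hi
    simp only [PiLp.add_apply, PiLp.smul_apply, smul_eq_mul, hxΛ i hi]
    have := abs_le.1 (hvi i)
    nlinarith [ht.1, ht.2, norm_nonneg v]
  have hface : ∀ t ∈ Icc (0 : ℝ) 1, x + t • v ∈ face Λ := fun t ht =>
    mem_face_iff.2 ⟨fun i hi => by linarith [hpath t ht i hi], fun i hi => by
      simp [hxΛ' i hi, hv i hi]⟩
  have hx0 : x ∈ face Λ := by simpa using hface 0 (by simp)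
  obtain ⟨δ, hδ, hU⟩ := hA3.upperRate (M := M) one_pos hx0 (hface 1 (by simp)) (c := c) (by simpa)
  obtain ⟨K, hK⟩ := (finite_range fun Λ' : Set (Fin N) => ‖coordProj Λ' (ones N)‖).bddAbove
  have hK' : ∀ Λ', ‖coordProj Λ' (ones N)‖ ≤ K := fun Λ' => hK ⟨Λ', rfl⟩
  have hK0 : 0 ≤ K := (norm_nonneg _).trans (hK' ∅)
  set m := min δ 2 with hm
  have hm0 : 0 < m := lt_min hδ two_pos
  obtain ⟨η, hη, hηm⟩ : ∃ η : ℝ, 0 < η ∧ (2 * K + 1) * η ≤ m / 4 :=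
    ⟨m / 4 / (2 * K + 1), by positivity, by field_simp; rfl⟩
  have hη2 : η ≤ m / 4 := by nlinarith
  refine ⟨η, hη, fun Λ' hΛ v' hv' hvv => ?_⟩
  -- The new coordinates start at `2 * η` and change by at most `η`, so the perturbed segment stays
  -- in the face of `Λ'`.
  set x' : Vec N := x + (2 * η) • coordProj (Λ' \ Λ) (ones N) with hx'
  have hxx : dist x' x ≤ 2 * K * η := by
    rw [hx', dist_eq_norm, add_sub_cancel_left, norm_smul, Real.norm_eq_abs,
      abs_of_pos (by linarith)]
    nlinarith [hK' (Λ' \ Λ)]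
  have hvi' : ∀ i, |v' i - v i| ≤ η := fun i =>
    (PiLp.norm_apply_le (v' - v) i).trans hvv.le
  have hpath' : ∀ t ∈ Icc (0 : ℝ) 1, x' + t • v' ∈ face Λ' := by
    refine fun t ht => mem_face_iff.2 ⟨fun i hi => ?_, fun i hi => ?_⟩
    · have h1 := abs_le.1 (hvi' i)
      by_cases hiΛ : i ∈ Λ
      · have h2 := hpath t ht i hiΛ
        simp only [hx', PiLp.add_apply, PiLp.smul_apply, smul_eq_mul,
          coordProj_of_notMem (fun h : i ∈ Λ' \ Λ => h.2 hiΛ)] at h2 ⊢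
        nlinarith [ht.1, ht.2, min_le_right δ 2]
      · simp only [hx', PiLp.add_apply, PiLp.smul_apply, smul_eq_mul,
          coordProj_of_mem (show i ∈ Λ' \ Λ from ⟨hi, hiΛ⟩), ones_apply, hxΛ' i hiΛ]
        rw [hv i hiΛ] at h1
        nlinarith [ht.1, ht.2]
    · have hiΛ : i ∉ Λ := fun h => hi (hΛ h)
      simp [hx', hxΛ' i hiΛ, hv' i hi, coordProj_of_notMem (fun h : i ∈ Λ' \ Λ => hi h.1)]
  -- A cheaper `v'` would, by (A₁), give the tube around the perturbed segment more probability than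
  -- (A₃) allows to the larger event around the original one.
  by_contra! hlt
  obtain ⟨c', hc1, hc2⟩ := ENNReal.lt_iff_exists_nnreal_btwn.1 hlt
  have hLR := hA1.lowerRate (M := M) (Λ := Λ') one_pos (fun t ht => (hpath' t ht).1)
    (fun t ht => hpath' t (Ioo_subset_Icc_self ht)) (c := c') (by simpa)
  have hx'o : x' ∈ orthant N := by simpa using (hpath' 0 (by simp)).1
  have hcc := hLR.le_upperRate hdense hx'o (x' := x) (δ := δ) (δ' := m / 4) (by linarith)
    (by nlinarith [min_le_left δ 2]) hU fun n => ?_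
  · exact absurd hc2 (not_lt.2 (by exact_mod_cast hcc))
  · refine (MarkovFamily.tube_subset_tube (le_refl 1) (φ := fun t => x + t • v) (δ := m)
      (η := m / 2) hm0 (by linarith) fun t ht => ?_).trans
      ((MarkovFamily.tube_subset_endEvent zero_le_one (fun t ht i hi =>
        (min_le_right δ 2).trans (hpath t ht i hi)) n).trans fun ω hω => ?_)
    · rw [dist_comm, dist_eq_norm]
      have e : x' + t • v' - (x + t • v) = (x' - x) + t • (v' - v) := by module
      rw [e]
      refine (norm_add_le _ _).trans ?_
      rw [norm_smul, Real.norm_eq_abs, abs_of_nonneg ht.1, ← dist_eq_norm]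
      nlinarith [ht.1, ht.2, norm_nonneg (v' - v)]
    · exact ⟨hω.1.trans_le (min_le_left _ _), hω.2⟩

/-- The hypotheses control `L Λ` only at velocities tangent to the face, hence the projection. -/
theorem lowerSemicontinuous_cost (hdense : M.DenseStates) (hA1 : M.A1 L) (hA3 : M.A3 L)
    (Λ : Set (Fin N)) : LowerSemicontinuous fun v => L Λ (coordProj Λ v) := by
  intro v c hc
  obtain ⟨c', h1, h2⟩ := ENNReal.lt_iff_exists_nnreal_btwn.1 hc
  obtain ⟨η, hη, h⟩ := exists_le_cost hdense hA1 hA3 (fun i hi => coordProj_of_notMem hi v) h2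
  have hcont : Continuous (coordProj Λ) := LinearMap.continuous_of_finiteDimensional _
  filter_upwards [hcont.continuousAt.eventually (Metric.ball_mem_nhds (coordProj Λ v) hη)]
    with v' hv'
  rw [dist_eq_norm] at hv'
  exact h1.trans_le (h Λ subset_rfl _ (fun i hi => coordProj_of_notMem hi v') hv')

theorem measurable_cost (hdense : M.DenseStates) (hA1 : M.A1 L) (hA3 : M.A3 L)
    (Λ : Set (Fin N)) : Measurable fun v => L Λ (coordProj Λ v) :=
  (lowerSemicontinuous_cost hdense hA1 hA3 Λ).measurable

theorem cost_zero_le (hdense : M.DenseStates) (hA1 : M.A1 L) (hA3 : M.A3 L) (Λ : Set (Fin N)) :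
    L Λ 0 ≤ L univ 0 := by
  by_contra! h
  obtain ⟨c, h1, h2⟩ := ENNReal.lt_iff_exists_nnreal_btwn.1 h
  obtain ⟨η, hη, h⟩ := exists_le_cost hdense hA1 hA3 (by simp) h2
  exact absurd (h univ (subset_univ _) 0 (by simp) (by simpa)) (not_le.2 h1)

theorem ennreal_convex {f : Vec N → ℝ≥0∞} (hf : ConvexOn ℝ≥0 univ f) (x y : Vec N) {a b : ℝ}
    (ha : 0 ≤ a) (hb : 0 ≤ b) (hab : a + b = 1) :
    f (a • x + b • y) ≤ ENNReal.ofReal a * f x + ENNReal.ofReal b * f y := by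
  lift a to ℝ≥0 using ha
  lift b to ℝ≥0 using hb
  have := hf.2 (mem_univ x) (mem_univ y) a.2 b.2 (by exact_mod_cast hab)
  simpa [ENNReal.smul_def, NNReal.smul_def] using this

/-- A finite convex function on an open ball is continuous, hence bounded near the centre. -/
theorem exists_cost_le (hconv : ConvexOn ℝ≥0 univ (L univ)) (hA2 : A2 L) :
    ∃ r : ℝ, 0 < r ∧ ∃ C : ℝ≥0, ∀ v, ‖v‖ ≤ r → L univ v ≤ C := by
  obtain ⟨R, hR, h⟩ := Metric.eventually_nhds_iff_ball.1 hA2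
  have hc : ConvexOn ℝ (Metric.ball 0 R) fun v => (L univ v).toReal := by
    refine ⟨convex_ball _ _, fun x hx y hy a b ha hb hab => ?_⟩
    have h1 := ENNReal.mul_ne_top (ENNReal.ofReal_ne_top (r := a)) (h x hx).ne
    have h2 := ENNReal.mul_ne_top (ENNReal.ofReal_ne_top (r := b)) (h y hy).ne
    have h3 := ENNReal.toReal_mono (ENNReal.add_ne_top.2 ⟨h1, h2⟩)
      (ennreal_convex hconv x y ha hb hab)
    rw [ENNReal.toReal_add h1 h2, ENNReal.toReal_mul, ENNReal.toReal_mul, ENNReal.toReal_ofReal ha,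
      ENNReal.toReal_ofReal hb] at h3
    simpa using h3
  have hcont := (hc.locallyLipschitzOn Metric.isOpen_ball).continuousOn.continuousAt
    (Metric.ball_mem_nhds 0 hR)
  have hev := (hcont.eventually (gt_mem_nhds (lt_add_one (L univ 0).toReal))).and hA2
  obtain ⟨r, hr, h'⟩ := Metric.nhds_basis_closedBall.eventually_iff.1 hev
  refine ⟨r, hr, ((L univ 0).toReal + 1).toNNReal, fun v hv => ?_⟩
  have h1 := h' (x := v) (by simpa using hv)
  rw [← ENNReal.ofReal_toReal h1.2.ne]
  exact ENNReal.ofReal_le_ofReal h1.1.le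

/-- Jensen's inequality on a face. -/
theorem mul_cost_average_le (hdense : M.DenseStates) (hA1 : M.A1 L) (hA3 : M.A3 L)
    {Λ : Set (Fin N)} (hconv : ConvexOn ℝ≥0 univ (L Λ)) {A : Set ℝ} (hA : MeasurableSet A)
    (h0 : volume A ≠ 0) (htop : volume A ≠ ⊤) {f : ℝ → Vec N} (hf : IntegrableOn f A)
    (hfΛ : ∀ᵐ t, t ∈ A → ∀ i ∉ Λ, f t i = 0) :
    volume A * L Λ ((volume A).toReal⁻¹ • ∫ t in A, f t) ≤ ∫⁻ t in A, L Λ (f t) := by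
  set F : Vec N → ℝ≥0∞ := fun v => L Λ (coordProj Λ v) with hF
  have hFm : Measurable F := measurable_cost hdense hA1 hA3 Λ
  have hproj : ∀ᵐ t ∂(volume.restrict A), coordProj Λ (f t) = f t := by
    rw [ae_restrict_iff' hA]
    filter_upwards [hfΛ] with t ht htA using coordProj_eq_self (ht htA)
  have hcongr : ∫⁻ t in A, L Λ (f t) = ∫⁻ t in A, F (f t) :=
    lintegral_congr_ae (hproj.mono fun t ht => by simp only [hF, ht])
  rw [hcongr]
  by_cases hfin : ∫⁻ t in A, F (f t) = ⊤
  · rw [hfin]; exact le_top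
  have hFae : AEMeasurable (fun t => F (f t)) (volume.restrict A) :=
    hFm.comp_aemeasurable hf.aemeasurable
  have hlt := ae_lt_top' hFae hfin
  have hg : Integrable (fun t => (F (f t)).toReal) (volume.restrict A) :=
    integrable_toReal_of_lintegral_ne_top hFae hfin
  -- The cost may be infinite, so Jensen's inequality is obtained by averaging the graph inside the
  -- epigraph, which is closed by semicontinuity and convex.
  set s : Set (Vec N × ℝ) := {p | F p.1 ≤ ENNReal.ofReal p.2 ∧ 0 ≤ p.2} with hs
  have hsc : IsClosed s := by
    refine IsClosed.inter ?_ (isClosed_le continuous_const continuous_snd)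
    have h1 := (lowerSemicontinuous_cost hdense hA1 hA3 Λ).isClosed_epigraph
    exact h1.preimage (f := fun p : Vec N × ℝ => (p.1, ENNReal.ofReal p.2))
      (continuous_fst.prodMk (ENNReal.continuous_ofReal.comp continuous_snd))
  have hsconv : Convex ℝ s := by
    rintro ⟨x, p⟩ ⟨hx, hp⟩ ⟨y, q⟩ ⟨hy, hq⟩ a b ha hb hab
    simp only at hx hy hp hq
    refine ⟨?_, by simp only [Prod.snd_add, Prod.smul_snd, smul_eq_mul]; positivity⟩
    simp only [Prod.fst_add, Prod.snd_add, Prod.smul_fst, Prod.smul_snd, smul_eq_mul, hF, map_add,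
      map_smul]
    refine (ennreal_convex hconv _ _ ha hb hab).trans ?_
    rw [ENNReal.ofReal_add (by positivity) (by positivity), ENNReal.ofReal_mul ha,
      ENNReal.ofReal_mul hb]
    gcongr
  have hmem := hsconv.set_average_mem hsc (f := fun t => (f t, (F (f t)).toReal)) h0 htop
    (hlt.mono fun t ht => ⟨(ENNReal.ofReal_toReal ht.ne).ge, ENNReal.toReal_nonneg⟩)
    (hf.prodMk hg)
  rw [setAverage_eq, integral_pair hf hg] at hmem
  have h1 := hmem.1
  simp only [Prod.smul_mk, measureReal_def, smul_eq_mul] at h1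
  have hvol : 0 < (volume A).toReal := ENNReal.toReal_pos h0 htop
  have hint : coordProj Λ (∫ t in A, f t) = ∫ t in A, f t := by
    have h2 := (LinearMap.toContinuousLinearMap (coordProj Λ)).integral_comp_comm hf
    simp only [LinearMap.coe_toContinuousLinearMap'] at h2
    rw [← h2]
    exact integral_congr_ae hproj
  simp only [hF, map_smul, hint] at h1
  calc _ ≤ volume A * ENNReal.ofReal ((volume A).toReal⁻¹ *
          ∫ t in A, (F (f t)).toReal) := by gcongr
    _ = ENNReal.ofReal (∫ t in A, (F (f t)).toReal) := by
      rw [← ENNReal.ofReal_toReal htop, ENNReal.toReal_ofReal hvol.le, ← ENNReal.ofReal_mul hvol.le]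
      congr 1
      field_simp
    _ = ∫⁻ t in A, F (f t) := by
      rw [ofReal_integral_eq_lintegral_ofReal hg (ae_of_all _ fun _ => ENNReal.toReal_nonneg)]
      exact lintegral_congr_ae (hlt.mono fun t ht => ENNReal.ofReal_toReal ht.ne)

end

/-! ### Piecewise linear paths and their action -/

section

variable {N : ℕ}

/-- Inductive description of the paths that are continuous and piecewise linear on `[0, T]`. -/
inductive PLPath (ψ : ℝ → Vec N) : ℝ → Prop
  | zero : PLPath ψ 0
  | snoc {S T : ℝ} (v : Vec N) : PLPath ψ S → S ≤ T →
      (∀ t ∈ Icc S T, ψ t = ψ S + (t - S) • v) → PLPath ψ T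

theorem PLPath.nonneg {ψ : ℝ → Vec N} {T : ℝ} (h : PLPath ψ T) : 0 ≤ T := by
  induction h with
  | zero => exact le_rfl
  | snoc v _ hST _ ih => exact ih.trans hST

theorem PLPath.congr {ψ χ : ℝ → Vec N} {T : ℝ} (h : PLPath ψ T) (he : EqOn ψ χ (Icc 0 T)) :
    PLPath χ T := by
  induction h with
  | zero => exact .zero
  | snoc v h hST hv ih =>
    refine .snoc v (ih (he.mono (Icc_subset_Icc_right hST))) hST fun t ht => ?_
    rw [← he ⟨h.nonneg.trans ht.1, ht.2⟩, ← he ⟨h.nonneg, hST⟩, hv t ht]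

theorem PLPath.restrict {ψ : ℝ → Vec N} {T : ℝ} (h : PLPath ψ T) {T' : ℝ} (h0 : 0 ≤ T')
    (hT : T' ≤ T) : PLPath ψ T' := by
  induction h with
  | zero => rw [le_antisymm hT h0]; exact .zero
  | @snoc S T v h hST hv ih =>
    rcases le_total T' S with hS | hS
    · exact ih hS
    · exact .snoc v h hS fun t ht => hv t ⟨ht.1, ht.2.trans hT⟩

theorem PLPath.continuousOn {ψ : ℝ → Vec N} {T : ℝ} (h : PLPath ψ T) :
    ContinuousOn ψ (Icc 0 T) := by
  induction h with
  | zero => rw [Icc_self]; exact continuousOn_singleton _ _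
  | @snoc S T v h hST hv ih =>
    rw [← Icc_union_Icc_eq_Icc h.nonneg hST]
    refine ih.union_of_isClosed ?_ isClosed_Icc isClosed_Icc
    refine ContinuousOn.congr ?_ hv
    fun_prop

/-- The path `ψ` until time `S`, followed by the path `χ`. -/
def append (S : ℝ) (ψ χ : ℝ → Vec N) (t : ℝ) : Vec N := if t ≤ S then ψ t else χ (t - S)

theorem append_left {S : ℝ} {ψ χ : ℝ → Vec N} {t : ℝ} (h : t ≤ S) : append S ψ χ t = ψ t :=
  if_pos h

theorem append_right {S : ℝ} {ψ χ : ℝ → Vec N} (he : ψ S = χ 0) {t : ℝ} (h : S ≤ t) :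
    append S ψ χ t = χ (t - S) := by
  rcases h.eq_or_lt with rfl | h
  · rw [append_left le_rfl, he, sub_self]
  · exact if_neg (not_le.2 h)

theorem PLPath.append {S T : ℝ} {ψ χ : ℝ → Vec N} (hψ : PLPath ψ S) (hχ : PLPath χ T)
    (he : ψ S = χ 0) : PLPath (append S ψ χ) (S + T) := by
  induction hχ with
  | zero =>
    rw [add_zero]
    exact hψ.congr fun t ht => (append_left ht.2).symm
  | @snoc T T' v h hT hv ih =>
    refine .snoc v ih (by gcongr) fun t ht => ?_
    have h1 := h.nonneg
    rw [append_right he (by linarith [ht.1]), append_right he (by linarith),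
      hv _ ⟨by linarith [ht.1], by linarith [ht.2]⟩]
    congr 2 <;> ring

theorem isPiecewiseLinear_iff {T : ℝ} {ψ : ℝ → Vec N} :
    IsPiecewiseLinear T ψ ↔ (∀ t ∈ Icc 0 T, ψ t ∈ orthant N) ∧ PLPath ψ T := by
  refine and_congr_right fun _ => ⟨?_, fun h => ?_⟩
  · rintro ⟨n, s, hs, h0, hT, h⟩
    rw [← hT]
    have : ∀ i ≤ n, PLPath ψ (s i) := by
      intro i hi
      induction i with
      | zero => rw [h0]; exact .zero
      | succ i ih =>
        refine .snoc ((s (i + 1) - s i)⁻¹ • (ψ (s (i + 1)) - ψ (s i))) (ih (by omega))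
          (hs (Nat.le_succ i)) fun t ht => ?_
        rw [h i (by omega) t ht, smul_smul, div_eq_mul_inv]
    exact this n le_rfl
  · induction h with
    | zero => exact ⟨0, fun _ => 0, monotone_const, rfl, rfl, by simp⟩
    | @snoc S T v h hST hv ih =>
      obtain ⟨n, s, hs, h0, hn, hlin⟩ := ih (by
        rename_i H; exact fun t ht => H t ⟨ht.1, ht.2.trans hST⟩)
      refine ⟨n + 1, fun j => if j ≤ n then s j else T, ?_, by simp [h0], by simp, ?_⟩
      · intro i j hij
        by_cases hj : j ≤ n
        · simp only [hj, hij.trans hj, if_true]; exact hs hij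
        · by_cases hi : i ≤ n
          · simp only [hi, hj, if_true, if_false]; exact (hs hi).trans (hn.trans_le hST)
          · simp [hi, hj]
      · intro i hi t ht
        rcases (Nat.lt_succ_iff.1 hi).eq_or_lt with rfl | hi'
        · simp only [le_refl, if_true, Nat.not_succ_le_self, if_false, hn] at ht ⊢
          rw [hv t ht, hv T ⟨hST, le_rfl⟩, add_sub_cancel_left, smul_smul]
          rcases hST.eq_or_lt with rfl | hlt
          · rw [le_antisymm ht.2 ht.1]; simp
          · rw [div_mul_cancel₀ _ (sub_pos.2 hlt).ne']
        · have h1 : i + 1 ≤ n := hi'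
          simp only [hi'.le, h1, if_true] at ht ⊢
          exact hlin i hi' t ht

/-- The action of a path on the time interval `(a, b]`. -/
def actionOn (L : Set (Fin N) → Vec N → ℝ≥0∞) (a b : ℝ) (ψ : ℝ → Vec N) : ℝ≥0∞ :=
  ∫⁻ t in Ioc a b, L (posSet (ψ t)) (deriv ψ t)

variable {L : Set (Fin N) → Vec N → ℝ≥0∞}

theorem action_eq_actionOn (T : ℝ) (ψ : ℝ → Vec N) : action L T ψ = actionOn L 0 T ψ := by
  rw [action, actionOn, restrict_Ioc_eq_restrict_Icc]

/-- The endpoints are a null set and the derivative is local inside, so the joints of concatenated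
paths do not matter. -/
theorem actionOn_congr {a b : ℝ} {ψ χ : ℝ → Vec N} (h : EqOn ψ χ (Ioo a b)) :
    actionOn L a b ψ = actionOn L a b χ := by
  rw [actionOn, actionOn, ← restrict_Ioo_eq_restrict_Ioc]
  refine setLIntegral_congr_fun measurableSet_Ioo fun t ht => ?_
  simp only [h ht, h.deriv isOpen_Ioo ht]

theorem actionOn_add {a b c : ℝ} (hab : a ≤ b) (hbc : b ≤ c) (ψ : ℝ → Vec N) :
    actionOn L a b ψ + actionOn L b c ψ = actionOn L a c ψ := by
  rw [actionOn, actionOn, actionOn, ← Ioc_union_Ioc_eq_Ioc hab hbc,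
    lintegral_union measurableSet_Ioc (Ioc_disjoint_Ioc_of_le le_rfl)]

theorem actionOn_mono {a b c : ℝ} (hbc : b ≤ c) (ψ : ℝ → Vec N) :
    actionOn L a b ψ ≤ actionOn L a c ψ :=
  lintegral_mono_set (Ioc_subset_Ioc_right hbc)

theorem actionOn_comp_sub (a b c : ℝ) (ψ : ℝ → Vec N) :
    actionOn L (a + c) (b + c) (fun t => ψ (t - c)) = actionOn L a b ψ := by
  simp only [actionOn, deriv_comp_sub_const]
  rw [← lintegral_indicator measurableSet_Ioc, ← lintegral_indicator measurableSet_Ioc,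
    ← lintegral_sub_right_eq_self ((Ioc a b).indicator fun t => L (posSet (ψ t)) (deriv ψ t)) c]
  refine lintegral_congr fun t => ?_
  simp only [indicator, mem_Ioc, lt_sub_iff_add_lt, sub_le_iff_le_add]

theorem actionOn_append {S T : ℝ} (hS : 0 ≤ S) (hT : 0 ≤ T) {ψ χ : ℝ → Vec N} (he : ψ S = χ 0) :
    actionOn L 0 (S + T) (append S ψ χ) = actionOn L 0 S ψ + actionOn L 0 T χ := by
  rw [← actionOn_add hS (by linarith : S ≤ S + T)]
  congr 1
  · exact actionOn_congr fun t ht => append_left ht.2.le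
  · rw [← actionOn_comp_sub 0 T S χ, zero_add, add_comm T S]
    exact actionOn_congr fun t ht => append_right he ht.1.le

theorem actionOn_linear {a b : ℝ} {ψ : ℝ → Vec N} {x v : Vec N} {Λ : Set (Fin N)}
    (h : ∀ t ∈ Ioo a b, ψ t = x + (t - a) • v) (hf : ∀ t ∈ Ioo a b, ψ t ∈ face Λ) :
    actionOn L a b ψ = ENNReal.ofReal (b - a) * L Λ v := by
  rw [actionOn_congr (χ := fun t => x + (t - a) • v) h, actionOn, ← restrict_Ioo_eq_restrict_Ioc]
  have : ∀ t ∈ Ioo a b, L (posSet (x + (t - a) • v)) (deriv (fun t => x + (t - a) • v) t) =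
      L Λ v := by
    intro t ht
    have h1 := (hf t ht).2
    rw [h t ht] at h1
    have h2 : HasDerivAt (fun t : ℝ => x + (t - a) • v) v t := by
      simpa using (((hasDerivAt_id t).sub_const a).smul_const v).const_add x
    rw [h1, h2.deriv]
  rw [setLIntegral_congr_fun measurableSet_Ioo this, setLIntegral_const, Real.volume_Ioo, mul_comm]

theorem convex_orthant (N : ℕ) : Convex ℝ (orthant N) := by
  intro x hx y hy a b ha hb _ i
  simp only [PiLp.add_apply, PiLp.smul_apply, smul_eq_mul]
  have := hx i
  have := hy i
  positivity

/-- The interior of a segment lies in one face. -/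
theorem segment_mem_face {x v : Vec N} {T : ℝ} (hx : x ∈ orthant N) (hy : x + T • v ∈ orthant N)
    {t : ℝ} (ht : t ∈ Ioo 0 T) : x + t • v ∈ face (posSet x ∪ posSet (x + T • v)) := by
  have hT : 0 < T := ht.1.trans ht.2
  have key : ∀ i, T * (x + t • v) i = (T - t) * x i + t * (x + T • v) i := by
    intro i
    simp only [PiLp.add_apply, PiLp.smul_apply, smul_eq_mul]
    ring
  have h1 : 0 < T - t := sub_pos.2 ht.2
  refine mem_face_iff.2 ⟨fun i hi => ?_, fun i hi => ?_⟩
  · refine pos_of_mul_pos_right (a := T) ?_ hT.le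
    rw [key]
    rcases hi with hi | hi
    · exact add_pos_of_pos_of_nonneg (mul_pos h1 hi) (mul_nonneg ht.1.le (hy i))
    · exact add_pos_of_nonneg_of_pos (mul_nonneg h1.le (hx i)) (mul_pos ht.1 hi)
  · have h2 : x i = 0 := le_antisymm (not_lt.1 fun h => hi (Or.inl h)) (hx i)
    have h3 : (x + T • v) i = 0 := le_antisymm (not_lt.1 fun h => hi (Or.inr h)) (hy i)
    have := key i
    rw [h2, h3, mul_zero, mul_zero, add_zero] at this
    exact (mul_eq_zero.1 this).resolve_left hT.ne'

theorem segment_mem_orthant {x v : Vec N} {T : ℝ} (hx : x ∈ orthant N)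
    (hy : x + T • v ∈ orthant N) {t : ℝ} (ht : t ∈ Icc 0 T) : x + t • v ∈ orthant N := by
  rcases ht.1.eq_or_lt with rfl | h0
  · simpa
  rcases ht.2.eq_or_lt with rfl | h1
  · exact hy
  exact (segment_mem_face hx hy ⟨h0, h1⟩).1

theorem exists_nnreal_add_le {a b : ℝ≥0∞} {c : ℝ≥0} (h : a + b < c) :
    ∃ c₁ c₂ : ℝ≥0, a < c₁ ∧ b < c₂ ∧ c₁ + c₂ ≤ c := by
  obtain ⟨ha, hb⟩ := ENNReal.add_ne_top.1 (h.trans ENNReal.coe_lt_top).ne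
  lift a to ℝ≥0 using ha
  lift b to ℝ≥0 using hb
  have h' : a + b < c := by exact_mod_cast h
  have hd : 0 < (c - (a + b)) / 2 := half_pos (tsub_pos_of_lt h')
  refine ⟨a + (c - (a + b)) / 2, b + (c - (a + b)) / 2, ?_, ?_, ?_⟩
  · exact_mod_cast lt_add_of_pos_right a hd
  · exact_mod_cast lt_add_of_pos_right b hd
  · rw [add_add_add_comm, add_halves, add_tsub_cancel_of_le h'.le]

/-- The local lower bound for piecewise linear paths. -/
theorem PLPath.lowerRate {Ω : Type*} [MeasurableSpace Ω] {M : MarkovFamily N Ω} (hA1 : M.A1 L)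
    {ψ : ℝ → Vec N} {T : ℝ} (h : PLPath ψ T) (ho : ∀ t ∈ Icc 0 T, ψ t ∈ orthant N) {c : ℝ≥0}
    (hc : actionOn L 0 T ψ < c) : M.LowerRate (ψ 0) (M.tube T ψ) c := by
  induction h generalizing c with
  | zero => exact (MarkovFamily.lowerRate_tube_zero ψ).mono c.2
  | @snoc S T v h hST hv ih =>
    have ih' := @ih fun t ht => ho t ⟨ht.1, ht.2.trans hST⟩
    rcases hST.eq_or_lt with rfl | hlt
    · exact ih' hc
    have hS0 := h.nonneg
    have hd : 0 < T - S := sub_pos.2 hlt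
    have hcont := (PLPath.snoc v h hST hv).continuousOn
    rw [← actionOn_add hS0 hST] at hc
    obtain ⟨c₁, c₂, h1, h2, h12⟩ := exists_nnreal_add_le hc
    have hend : ψ S + (T - S) • v ∈ orthant N := by
      rw [← hv T ⟨hST, le_rfl⟩]; exact ho T ⟨hS0.trans hST, le_rfl⟩
    have hS := ho S ⟨hS0, hST⟩
    -- The ends may lie in smaller faces, but the open segment lies in a single one, which is what
    -- (A₁) asks for.
    have hseg : ∀ t ∈ Ioo S T, ψ t ∈ face (posSet (ψ S) ∪ posSet (ψ S + (T - S) • v)) :=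
      fun t ht => by
        rw [hv t (Ioo_subset_Icc_self ht)]
        exact segment_mem_face hS hend ⟨sub_pos.2 ht.1, by linarith [ht.2]⟩
    rw [actionOn_linear (fun t ht => hv t (Ioo_subset_Icc_self ht)) hseg] at h2
    have hL2 := hA1.lowerRate (M := M) hd
      (fun t ht => segment_mem_orthant hS hend ht) (fun t ht => segment_mem_face hS hend ht) h2
    have hL1 := ih' h1
    have htube : M.tube (T - S) (fun t => ψ (S + t)) = M.tube (T - S) fun t => ψ S + t • v :=
      MarkovFamily.tube_congr fun t ht => by
        show ψ (S + t) = _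
        rw [hv (S + t) ⟨by linarith [ht.1], by linarith [ht.2]⟩, add_sub_cancel_left]
    rw [← htube] at hL2
    lift S to ℝ≥0 using hS0
    obtain ⟨R, hR⟩ : ∃ R : ℝ≥0, (R : ℝ) = T - S := ⟨⟨T - S, hd.le⟩, rfl⟩
    obtain rfl : T = S + R := by rw [hR]; ring
    rw [← hR] at hL2
    exact (hL1.add hcont hL2).mono (by exact_mod_cast h12)

end

/-! ### Short connections and the lower bound by the regularized action -/

section

variable {N : ℕ} {L : Set (Fin N) → Vec N → ℝ≥0∞}

/-- There is a piecewise linear path in `S` from `x` to `y` with duration `σ` and action at most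
`c`. -/
def Connected (L : Set (Fin N) → Vec N → ℝ≥0∞) (S : Set (Vec N)) (x y : Vec N) (σ : ℝ)
    (c : ℝ≥0∞) : Prop :=
  ∃ ψ : ℝ → Vec N, PLPath ψ σ ∧ ψ 0 = x ∧ ψ σ = y ∧ (∀ t ∈ Icc 0 σ, ψ t ∈ S) ∧
    actionOn L 0 σ ψ ≤ c

theorem Connected.refl {S : Set (Vec N)} {x : Vec N} (hx : x ∈ S) : Connected L S x x 0 0 :=
  ⟨fun _ => x, .zero, rfl, rfl, fun _ _ => hx, by simp [actionOn]⟩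

theorem Connected.nonneg {S : Set (Vec N)} {x y : Vec N} {σ : ℝ} {c : ℝ≥0∞}
    (h : Connected L S x y σ c) : 0 ≤ σ := let ⟨_, h, _⟩ := h; h.nonneg

theorem Connected.mono {S : Set (Vec N)} {x y : Vec N} {σ : ℝ} {c c' : ℝ≥0∞}
    (h : Connected L S x y σ c) (hc : c ≤ c') : Connected L S x y σ c' :=
  let ⟨ψ, h1, h2, h3, h4, h5⟩ := h; ⟨ψ, h1, h2, h3, h4, h5.trans hc⟩

theorem append_mem {S T : ℝ} {ψ χ : ℝ → Vec N} (he : ψ S = χ 0) {P : ℝ → Vec N → Prop}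
    (h : ∀ t ∈ Icc 0 S, P t (ψ t)) (h' : ∀ t ∈ Icc 0 T, P (S + t) (χ t)) :
    ∀ t ∈ Icc 0 (S + T), P t (append S ψ χ t) := by
  intro t ht
  rcases le_total t S with hS | hS
  · rw [append_left hS]; exact h t ⟨ht.1, hS⟩
  · rw [append_right he hS]
    have := h' (t - S) ⟨by linarith, by linarith [ht.2]⟩
    rwa [add_sub_cancel] at this

theorem append_zero {S : ℝ} (hS : 0 ≤ S) {ψ χ : ℝ → Vec N} : append S ψ χ 0 = ψ 0 :=
  append_left hS

theorem append_end {S T : ℝ} (hT : 0 ≤ T) {ψ χ : ℝ → Vec N} (he : ψ S = χ 0) :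
    append S ψ χ (S + T) = χ T := by
  rw [append_right he (by linarith), add_sub_cancel_left]

theorem Connected.trans {S : Set (Vec N)} {x y z : Vec N} {σ σ' : ℝ} {c c' : ℝ≥0∞}
    (h : Connected L S x y σ c) (h' : Connected L S y z σ' c') :
    Connected L S x z (σ + σ') (c + c') := by
  obtain ⟨ψ, h1, h2, h3, h4, h5⟩ := h
  obtain ⟨χ, g1, g2, g3, g4, g5⟩ := h'
  have he := h3.trans g2.symm
  refine ⟨append σ ψ χ, h1.append g1 he, (append_zero h1.nonneg).trans h2,
    (append_end g1.nonneg he).trans g3, append_mem he h4 g4, ?_⟩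
  rw [actionOn_append h1.nonneg g1.nonneg he]
  exact add_le_add h5 g5

theorem connected_segment {S : Set (Vec N)} (hS : Convex ℝ S) (hSo : S ⊆ orthant N)
    {x y : Vec N} (hx : x ∈ S) (hy : y ∈ S) {σ : ℝ} (hσ : 0 < σ) :
    Connected L S x y σ (ENNReal.ofReal σ * L (posSet x ∪ posSet y) (σ⁻¹ • (y - x))) := by
  have hend : x + σ • (σ⁻¹ • (y - x)) = y := by
    rw [smul_smul, mul_inv_cancel₀ hσ.ne', one_smul, add_sub_cancel]
  have hmem : ∀ t ∈ Icc 0 σ, x + t • (σ⁻¹ • (y - x)) ∈ S := by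
    intro t ht
    have : x + t • (σ⁻¹ • (y - x)) = (1 - t * σ⁻¹) • x + (t * σ⁻¹) • y := by module
    rw [this, ← div_eq_mul_inv]
    have h1 : t / σ ≤ 1 := div_le_one_of_le₀ ht.2 hσ.le
    exact hS hx hy (by linarith) (div_nonneg ht.1 hσ.le) (by ring)
  refine ⟨fun t => x + t • (σ⁻¹ • (y - x)), ?_, by simp, hend, hmem, ?_⟩
  · exact .snoc (σ⁻¹ • (y - x)) .zero hσ.le fun t _ => by simp
  · refine (actionOn_linear (x := x) (fun t _ => by rw [sub_zero])
      (Λ := posSet x ∪ posSet y) fun t ht => ?_).le.trans (by rw [sub_zero])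
    have := segment_mem_face (T := σ) (v := σ⁻¹ • (y - x)) (hSo hx) (by rw [hend]; exact hSo hy) ht
    rwa [hend] at this

/-- Any two points can be connected at a cost of at most `K` times their distance. -/
def ConnectingConst (L : Set (Fin N) → Vec N → ℝ≥0∞) (K : ℝ) : Prop :=
  1 ≤ K ∧ ∀ S : Set (Vec N), Convex ℝ S → S ⊆ orthant N → ∀ x ∈ S, ∀ y ∈ S,
    orthant N ∩ Metric.closedBall x (K * ‖y - x‖) ⊆ S →
    ∃ σ, σ ≤ K * ‖y - x‖ ∧ Connected L S x y σ (ENNReal.ofReal (K * ‖y - x‖))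

/-- The connection passes through the interior point `x + ‖y - x‖ • ones N`. Both legs then have
only positive coordinates inside and are charged by `L univ` alone. A duration proportional to the
distance keeps the speed in the ball where this cost is bounded. -/
theorem exists_connectingConst (hconv : ConvexOn ℝ≥0 univ (L univ)) (hA2 : A2 L) :
    ∃ K, ConnectingConst L K := by
  obtain ⟨r, hr, C, hC⟩ := exists_cost_le hconv hA2
  set k : ℝ := ‖ones N‖ + 1 with hk
  have hk0 : 0 < k := by positivity
  -- The entries bound the size of the detour, the total duration and the total cost, each per unit
  -- of distance.
  set K : ℝ := max (max 1 k) (max (2 * k / r) (C * (2 * k / r))) with hK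
  refine ⟨K, (le_max_left _ _).trans (le_max_left _ _), fun S hS hSo x hx y hy hsub => ?_⟩
  rcases eq_or_ne y x with rfl | hne
  · exact ⟨0, by simp, (Connected.refl hx).mono (by simp)⟩
  set d := ‖y - x‖ with hd
  have hd0 : 0 < d := norm_pos_iff.2 (sub_ne_zero.2 hne)
  set m : Vec N := x + d • ones N with hm
  have hmpos : ∀ i, 0 < m i := fun i => by
    have := hSo hx i
    simp only [hm, PiLp.add_apply, PiLp.smul_apply, ones_apply, smul_eq_mul, mul_one]
    linarith
  have hmu : posSet m = univ := eq_univ_of_forall hmpos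
  have hmS : m ∈ S := by
    refine hsub ⟨fun i => (hmpos i).le, ?_⟩
    rw [Metric.mem_closedBall, dist_eq_norm, hm, add_sub_cancel_left, norm_smul, Real.norm_eq_abs,
      abs_of_pos hd0, mul_comm K]
    refine mul_le_mul_of_nonneg_left ?_ hd0.le
    have : k ≤ K := (le_max_right _ _).trans (le_max_left _ _)
    linarith
  have hσ : 0 < d * k / r := by positivity
  have hspeed : ∀ u : Vec N, ‖u‖ ≤ d * k → L univ ((d * k / r)⁻¹ • u) ≤ C := by
    intro u hu
    refine hC _ ?_
    rw [norm_smul, norm_inv, Real.norm_eq_abs, abs_of_pos hσ, inv_mul_le_iff₀ hσ]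
    calc ‖u‖ ≤ d * k := hu
      _ = _ := by field_simp
  have hnorm : ‖d • ones N‖ = d * ‖ones N‖ := by
    rw [norm_smul, Real.norm_eq_abs, abs_of_pos hd0]
  have c1 := connected_segment (L := L) hS hSo hx hmS hσ
  have c2 := connected_segment (L := L) hS hSo hmS hy hσ
  rw [hmu, union_univ] at c1
  rw [hmu, univ_union] at c2
  refine ⟨d * k / r + d * k / r, ?_, (c1.trans c2).mono ?_⟩
  · have : 2 * k / r ≤ K := (le_max_left _ _).trans (le_max_right _ _)
    calc d * k / r + d * k / r = 2 * k / r * d := by ring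
      _ ≤ K * d := by gcongr
  · have e1 : L univ ((d * k / r)⁻¹ • (m - x)) ≤ C := hspeed _ (by
      rw [hm, add_sub_cancel_left, hnorm]; nlinarith)
    have e2 : L univ ((d * k / r)⁻¹ • (y - m)) ≤ C := hspeed _ (by
      have : y - m = (y - x) - d • ones N := by rw [hm]; abel
      rw [this]
      refine (norm_sub_le _ _).trans ?_
      rw [hnorm, ← hd, hk]
      linarith)
    have : C * (2 * k / r) ≤ K := (le_max_right _ _).trans (le_max_right _ _)
    calc _ ≤ ENNReal.ofReal (d * k / r) * C + ENNReal.ofReal (d * k / r) * C := by gcongr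
      _ = ENNReal.ofReal (C * (2 * k / r) * d) := by
        rw [← ENNReal.ofReal_coe_nnreal, ← ENNReal.ofReal_mul hσ.le, ← ENNReal.ofReal_add
          (by positivity) (by positivity)]
        congr 1
        ring
      _ ≤ _ := by gcongr

/-- The time change moves each time by less than `ε`, and the modulus of continuity of `φ` absorbs
it. -/
theorem dist_le_of_skorohodDist_lt {T e ε : ℝ} {φ ψ : ℝ → Vec N}
    (hφ : ∀ s ∈ Icc 0 T, ∀ t ∈ Icc 0 T, dist s t < ε → dist (φ s) (φ t) ≤ e)
    (h : skorohodDist T φ ψ < ENNReal.ofReal ε) {t : ℝ} (ht : t ∈ Icc 0 T) :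
    dist (φ t) (ψ t) ≤ e + ε := by
  rw [skorohodDist, iInf_lt_iff] at h
  obtain ⟨r, hr⟩ := h
  obtain ⟨h1, h2⟩ := max_lt_iff.1 hr
  set s := r.symm ⟨t, ht⟩ with hs
  have hrs : r s = ⟨t, ht⟩ := r.apply_symm_apply _
  have h3 := (le_iSup (fun t => edist (r t) t) s).trans_lt h1
  have h4 := (le_iSup (fun t : Icc (0 : ℝ) T => edist (φ t) (ψ (r t))) s).trans_lt h2
  rw [hrs, edist_dist] at h3 h4
  have h5 := (ENNReal.ofReal_lt_ofReal_iff_of_nonneg dist_nonneg).1 h3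
  have h6 := (ENNReal.ofReal_lt_ofReal_iff_of_nonneg dist_nonneg).1 h4
  have h7 := hφ t ht s s.2 h5
  have := dist_triangle (φ t) (φ s) (ψ t)
  simp only at h6
  linarith

/-- The local lower bound with the regularized action. -/
theorem neg_rateI_le_w {Ω : Type*} [MeasurableSpace Ω] {M : MarkovFamily N Ω}
    (hconv : ConvexOn ℝ≥0 univ (L univ)) (hA1 : M.A1 L) (hA2 : A2 L)
    {T : ℝ} (hT : 0 < T) {φ : ℝ → Vec N} (hφo : ∀ t ∈ Icc 0 T, φ t ∈ orthant N)
    (hφ : UniformContinuousOn φ (Icc 0 T)) : -(rateI L T φ : EReal) ≤ M.w T φ := by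
  refine MarkovFamily.le_lowerExponent_neg fun c hc δ hδ => ?_
  obtain ⟨K, hK1, hK⟩ := exists_connectingConst hconv hA2
  obtain ⟨c₁, c₂, h1, h2, h12⟩ := exists_nnreal_add_le (a := rateI L T φ) (b := 0) (c := c)
    (by simpa)
  have hc2 : (0 : ℝ) < c₂ := by exact_mod_cast h2
  rw [Metric.uniformContinuousOn_iff] at hφ
  obtain ⟨η, hη, hmod⟩ := hφ (δ / 8) (by positivity)
  -- The connection from `φ 0` to `ψ 0` has duration, excursion and cost at most `K * e`; these must
  -- fit the modulus `η`, the tube and the slack `c₂`.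
  obtain ⟨e, he0, heη, heδ, hec⟩ : ∃ e : ℝ, 0 < e ∧ K * e < η ∧ K * e ≤ δ / 8 ∧ K * e < c₂ := by
    have hm : 0 < min (min η (δ / 8)) c₂ := by positivity
    refine ⟨min (min η (δ / 8)) c₂ / (2 * K), by positivity, ?_⟩
    have : K * (min (min η (δ / 8)) c₂ / (2 * K)) = min (min η (δ / 8)) c₂ / 2 := by field_simp
    rw [this]
    have a1 := min_le_left (min η (δ / 8)) (c₂ : ℝ)
    have a2 := min_le_right (min η (δ / 8)) (c₂ : ℝ)
    have a3 := min_le_left η (δ / 8)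
    have a4 := min_le_right η (δ / 8)
    refine ⟨?_, ?_, ?_⟩ <;> linarith
  have heδ' : e ≤ δ / 8 := by nlinarith
  obtain ⟨η', hη', hmod'⟩ := hφ (e / 2) (by positivity)
  have hε : 0 < min η' (e / 2) := by positivity
  have hI := (le_iSup₂ (f := fun (δ : ℝ) (_ : 0 < δ) => ⨅ (ψ : ℝ → Vec N)
    (_ : IsPiecewiseLinear T ψ ∧ skorohodDist T φ ψ < ENNReal.ofReal δ), action L T ψ) _ hε).trans_lt
    h1
  simp only [iInf_lt_iff] at hI
  obtain ⟨ψ, ⟨hψ, hd⟩, hact⟩ := hI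
  rw [isPiecewiseLinear_iff] at hψ
  rw [action_eq_actionOn] at hact
  have hdist : ∀ t ∈ Icc 0 T, dist (φ t) (ψ t) ≤ e := fun t ht =>
    (dist_le_of_skorohodDist_lt (e := e / 2) (fun s hs t ht hst =>
      (hmod' s hs t ht (hst.trans_le (min_le_left _ _))).le) hd ht).trans
      (by linarith [min_le_right η' (e / 2)])
  have h0T : (0 : ℝ) ∈ Icc 0 T := ⟨le_rfl, hT.le⟩
  have hd0 : ‖ψ 0 - φ 0‖ ≤ e := by rw [← dist_eq_norm, dist_comm]; exact hdist 0 h0T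
  have hKe : K * ‖ψ 0 - φ 0‖ ≤ K * e := by gcongr
  obtain ⟨σ, hσ, χ, k1, k2, k3, k4, k5⟩ := hK (orthant N ∩ Metric.closedBall (φ 0) (K * e))
    ((convex_orthant N).inter (convex_closedBall _ _)) inter_subset_left (φ 0)
    ⟨hφo 0 h0T, Metric.mem_closedBall_self (by positivity)⟩ (ψ 0) ⟨hψ.1 0 h0T, by
      rw [Metric.mem_closedBall, dist_eq_norm]; nlinarith⟩
    (inter_subset_inter_right _ (Metric.closedBall_subset_closedBall hKe))
  have hσ' : σ ≤ K * e := hσ.trans hKe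
  have hσ0 := k1.nonneg
  have hL := (k1.append hψ.2 k3).lowerRate hA1 (append_mem (P := fun _ x => x ∈ orthant N) k3
    (fun t ht => (k4 t ht).1) hψ.1) (c := c) (by
      rw [actionOn_append hσ0 hT.le k3]
      refine lt_of_lt_of_le (ENNReal.add_lt_add_of_le_of_lt (ne_top_of_le_ne_top
        ENNReal.ofReal_ne_top k5) (k5.trans (ENNReal.ofReal_le_ofReal (hKe.trans hec.le))) hact) ?_
      rw [ENNReal.ofReal_coe_nnreal, add_comm]
      exact_mod_cast h12)
  rw [append_zero hσ0, k2] at hL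
  obtain ⟨ε, hε, hL⟩ := hL (δ / 4) (by positivity)
  refine ⟨ε, hε, hL.mono fun n hn y hy => (hn y hy).trans (measure_mono ?_)⟩
  -- The joined path lasts `σ + T` and runs behind `ψ` by `σ`; on `[0, T]` this delay is below the
  -- modulus of continuity of `φ`.
  refine MarkovFamily.tube_subset_tube (by linarith) hδ (show δ / 4 + δ / 2 < δ by linarith) ?_
  intro t ht
  refine append_mem (T := T) (P := fun t x => t ∈ Icc 0 T → dist (φ t) x ≤ δ / 2) k3 ?_ ?_ t
    ⟨ht.1, by linarith [ht.2]⟩ ht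
  · intro t ht hT'
    have a1 := (k4 t ht).2
    rw [Metric.mem_closedBall, dist_comm] at a1
    have a2 := hmod t hT' 0 h0T (by
      rw [Real.dist_0_eq_abs, abs_of_nonneg ht.1]; linarith [ht.2])
    linarith [dist_triangle (φ t) (φ 0) (χ t)]
  · intro t ht hT'
    have a1 := hdist t ht
    have a2 := hmod (σ + t) hT' t ht (by
      rw [Real.dist_eq, add_sub_cancel_right, abs_of_nonneg hσ0]; linarith)
    linarith [dist_triangle (φ (σ + t)) (φ t) (ψ t)]

end

/-! ### Absolutely continuous paths and regular times -/

section

variable {N : ℕ} {T : ℝ} {φ : ℝ → Vec N}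

theorem _root_.AbsolutelyContinuousOnInterval.apply (h : AbsolutelyContinuousOnInterval φ 0 T)
    (i : Fin N) : AbsolutelyContinuousOnInterval (fun t => φ t i) 0 T := by
  rw [absolutelyContinuousOnInterval_iff] at h ⊢
  intro ε hε
  obtain ⟨δ, hδ, h⟩ := h ε hε
  refine ⟨δ, hδ, fun E hE hlt => lt_of_le_of_lt (Finset.sum_le_sum fun j _ => ?_) (h E hE hlt)⟩
  rw [dist_eq_norm, dist_eq_norm]
  exact PiLp.norm_apply_le (φ (E.2 j).1 - φ (E.2 j).2) i

theorem hasDerivAt_apply {v : Vec N} {t : ℝ} (h : HasDerivAt φ v t) (i : Fin N) :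
    HasDerivAt (fun t => φ t i) (v i) t :=
  (EuclideanSpace.proj (𝕜 := ℝ) i).hasFDerivAt.comp_hasDerivAt t h

theorem ae_hasDerivAt (h : AbsolutelyContinuousOnInterval φ 0 T) (hT : 0 ≤ T) :
    ∀ᵐ t, t ∈ Icc 0 T → HasDerivAt φ (deriv φ t) t := by
  filter_upwards [ae_all_iff.2 fun i => (h.apply i).ae_differentiableAt] with t ht htT
  rw [uIcc_of_le hT] at ht
  exact (differentiableAt_euclidean.2 fun i => ht i htT).hasDerivAt

theorem integrableOn_deriv (h : AbsolutelyContinuousOnInterval φ 0 T) (hT : 0 ≤ T) :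
    IntegrableOn (deriv φ) (Icc 0 T) := by
  refine Integrable.of_eval_piLp fun i => ?_
  have h1 := (h.apply i).intervalIntegrable_deriv
  rw [intervalIntegrable_iff_integrableOn_Icc_of_le hT] at h1
  refine h1.congr ?_
  rw [EventuallyEq, ae_restrict_iff' measurableSet_Icc]
  filter_upwards [ae_hasDerivAt h hT] with t ht htT using (hasDerivAt_apply (ht htT) i).deriv

theorem integral_deriv_eq (h : AbsolutelyContinuousOnInterval φ 0 T) {a b : ℝ} (ha : 0 ≤ a)
    (hab : a ≤ b) (hb : b ≤ T) : ∫ t in Ioc a b, deriv φ t = φ b - φ a := by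
  have hT : 0 ≤ T := ha.trans (hab.trans hb)
  have hsub : Ioc a b ⊆ Icc 0 T := fun t ht => ⟨ha.trans ht.1.le, ht.2.trans hb⟩
  have hint : IntegrableOn (deriv φ) (Ioc a b) := (integrableOn_deriv h hT).mono_set hsub
  ext i
  rw [eval_integral_piLp fun i => hint.eval_piLp i]
  have h2 : AbsolutelyContinuousOnInterval (fun t => φ t i) a b := (h.apply i).mono (by
    rw [uIcc_of_le hab, uIcc_of_le hT]; exact Icc_subset_Icc ha hb)
  have h3 := h2.integral_deriv_eq_sub
  rw [intervalIntegral.integral_of_le hab] at h3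
  rw [PiLp.sub_apply, ← h3]
  refine integral_congr_ae ?_
  rw [EventuallyEq, ae_restrict_iff' measurableSet_Ioc]
  filter_upwards [ae_hasDerivAt h hT] with t ht htT
  exact (hasDerivAt_apply (ht (hsub htT)) i).deriv.symm

/-- The velocity of a path in the orthant is tangent to the face. -/
theorem deriv_eq_zero_of_face (hφo : ∀ t ∈ Icc 0 T, φ t ∈ orthant N) {t : ℝ} (ht : t ∈ Ioo 0 T)
    {v : Vec N} (hv : HasDerivAt φ v t) {i : Fin N} (hi : i ∉ posSet (φ t)) : v i = 0 := by
  have h0 : φ t i = 0 := le_antisymm (not_lt.1 hi) (hφo t (Ioo_subset_Icc_self ht) i)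
  -- A nonnegative coordinate that vanishes at an interior time has a minimum there.
  have hmin : IsLocalMin (fun t => φ t i) t := by
    filter_upwards [isOpen_Ioo.mem_nhds ht] with s hs
    rw [h0]
    exact hφo s (Ioo_subset_Icc_self hs) i
  exact hmin.hasDerivAt_eq_zero (hasDerivAt_apply hv i)

theorem ae_deriv_eq_zero_of_face (h : AbsolutelyContinuousOnInterval φ 0 T) (hT : 0 ≤ T)
    (hφo : ∀ t ∈ Icc 0 T, φ t ∈ orthant N) :
    ∀ᵐ t, t ∈ Icc 0 T → HasDerivAt φ (deriv φ t) t ∧ ∀ i ∉ posSet (φ t), deriv φ t i = 0 := by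
  filter_upwards [ae_hasDerivAt h hT, Measure.ae_ne volume 0, Measure.ae_ne volume T]
    with t ht h0 h1 htT
  exact ⟨ht htT, fun i hi => deriv_eq_zero_of_face hφo
    ⟨htT.1.lt_of_ne h0.symm, htT.2.lt_of_ne h1⟩ (ht htT) hi⟩

/-- The times at which all the positive coordinates of the path are at least `δ`. -/
def regularTimes (T : ℝ) (φ : ℝ → Vec N) (δ : ℝ) : Set ℝ :=
  {t | t ∈ Icc 0 T ∧ ∀ i, φ t i = 0 ∨ δ ≤ φ t i}

theorem isClosed_regularTimes (hφ : ContinuousOn φ (Icc 0 T)) (δ : ℝ) :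
    IsClosed (regularTimes T φ δ) := by
  have hi : ∀ i, ContinuousOn (fun t => φ t i) (Icc 0 T) := fun i =>
    (EuclideanSpace.proj (𝕜 := ℝ) i).continuous.comp_continuousOn hφ
  have : regularTimes T φ δ = Icc 0 T ∩ ⋂ i, (Icc 0 T ∩ (fun t => φ t i) ⁻¹' ({0} ∪ Ici δ)) := by
    ext t
    simp only [regularTimes, mem_inter_iff, mem_iInter, mem_preimage, mem_union,
      mem_singleton_iff, mem_Ici, mem_ofPred_eq]
    exact ⟨fun h => ⟨h.1, fun i => ⟨h.1, h.2 i⟩⟩, fun h => ⟨h.1, fun i => (h.2 i).2⟩⟩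
  rw [this]
  exact isClosed_Icc.inter (isClosed_iInter fun i =>
    (hi i).preimage_isClosed_of_isClosed isClosed_Icc (isClosed_singleton.union isClosed_Ici))

theorem le_of_mem_regularTimes {δ t : ℝ} (ht : t ∈ regularTimes T φ δ) {i : Fin N}
    (hi : i ∈ posSet (φ t)) : δ ≤ φ t i :=
  (ht.2 i).resolve_left (ne_of_gt hi)

/-- At regular times a positive coordinate is at least `δ`, and a displacement below `δ` cannot
bring it to zero. -/
theorem posSet_eq_of_mem_regularTimes {δ s t : ℝ}
    (hs : s ∈ regularTimes T φ δ) (ht : t ∈ regularTimes T φ δ) (hst : ‖φ s - φ t‖ < δ) :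
    posSet (φ s) = posSet (φ t) := by
  have key : ∀ {s t}, s ∈ regularTimes T φ δ → ‖φ s - φ t‖ < δ → posSet (φ s) ⊆ posSet (φ t) := by
    intro s t hs hst i hi
    have h1 := le_of_mem_regularTimes hs hi
    have h2 := (PiLp.norm_apply_le (φ s - φ t) i).trans_lt hst
    rw [Real.norm_eq_abs, PiLp.sub_apply] at h2
    have := (abs_lt.1 h2).2
    show 0 < φ t i
    linarith
  exact (key hs hst).antisymm (key ht (by rwa [norm_sub_rev]))

theorem exists_mem_regularTimes (hφo : ∀ t ∈ Icc 0 T, φ t ∈ orthant N) {t : ℝ} (ht : t ∈ Icc 0 T) :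
    ∃ δ : ℝ, 0 < δ ∧ t ∈ regularTimes T φ δ := by
  have h : ∀ i : Fin N, ∀ᶠ δ in 𝓝[>] (0 : ℝ), φ t i = 0 ∨ δ ≤ φ t i := by
    intro i
    rcases (hφo t ht i).eq_or_lt with h0 | h0
    · exact Eventually.of_forall fun _ => Or.inl h0.symm
    · filter_upwards [nhdsWithin_le_nhds (Iio_mem_nhds h0)] with δ hδ using Or.inr (le_of_lt hδ)
  obtain ⟨δ, h1, h2⟩ := ((eventually_all.2 h).and self_mem_nhdsWithin).exists
  exact ⟨δ, h2, ht, h1⟩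

theorem regularTimes_anti {δ δ' : ℝ} (h : δ ≤ δ') : regularTimes T φ δ' ⊆ regularTimes T φ δ :=
  fun _ ht => ⟨ht.1, fun i => (ht.2 i).imp_right h.trans⟩

/-- One plus the speed of the path. -/
def speed (φ : ℝ → Vec N) (t : ℝ) : ℝ := 1 + ‖deriv φ t‖

theorem one_le_speed (t : ℝ) : 1 ≤ speed φ t := by simp [speed]

theorem integrableOn_speed (h : AbsolutelyContinuousOnInterval φ 0 T) (hT : 0 ≤ T) :
    IntegrableOn (speed φ) (Icc 0 T) :=
  (integrable_const 1).add (integrableOn_deriv h hT).norm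

theorem setIntegral_speed_mono {A B : Set ℝ} (hB : IntegrableOn (speed φ) B)
    (hAB : A ≤ᵐ[volume] B) : ∫ t in A, speed φ t ≤ ∫ t in B, speed φ t :=
  setIntegral_mono_set hB (ae_of_all _ fun t => zero_le_one.trans (one_le_speed t)) hAB

theorem norm_setIntegral_deriv_le {A : Set ℝ} (hA : IntegrableOn (speed φ) A) :
    ‖∫ t in A, deriv φ t‖ ≤ ∫ t in A, speed φ t := by
  refine norm_integral_le_of_norm_le hA (ae_of_all _ fun t => ?_)
  simp [speed]

theorem volume_le_setIntegral_speed {A : Set ℝ} (hA : IntegrableOn (speed φ) A) :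
    (volume A).toReal ≤ ∫ t in A, speed φ t := by
  have : (volume A).toReal = ∫ _ in A, (1 : ℝ) := by simp [measureReal_def]
  rw [this]
  refine integral_mono_of_nonneg (ae_of_all _ fun _ => zero_le_one) hA (ae_of_all _ one_le_speed)

/-- Each time is regular for small `δ`, since there are finitely many coordinates, so the irregular
sets decrease to the empty set. The weight `speed` bounds both the time and the displacement lost on
them. -/
theorem exists_regularTimes_small (h : AbsolutelyContinuousOnInterval φ 0 T) (hT : 0 ≤ T)
    (hφo : ∀ t ∈ Icc 0 T, φ t ∈ orthant N) {ε : ℝ} (hε : 0 < ε) :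
    ∃ δ, 0 < δ ∧ δ < ε ∧ ∫ t in Icc 0 T \ regularTimes T φ δ, speed φ t < ε := by
  have hφ : ContinuousOn φ (Icc 0 T) := by simpa [uIcc_of_le hT] using h.continuousOn
  set δ : ℕ → ℝ := fun m => 1 / ((m : ℝ) + 1) with hδ
  have hδ0 : ∀ m, 0 < δ m := fun m => by positivity
  have hδa : Antitone δ := fun m m' hm => by
    simp only [hδ]; gcongr
  have hlim : Tendsto δ atTop (𝓝 0) := tendsto_one_div_add_atTop_nhds_zero_nat
  have hanti : Antitone fun m => Icc 0 T \ regularTimes T φ (δ m) := fun m m' hm =>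
    sdiff_le_sdiff_left (regularTimes_anti (hδa hm))
  have key := tendsto_setIntegral_of_antitone (μ := volume) (f := speed φ)
    (fun m => measurableSet_Icc.diff (isClosed_regularTimes hφ (δ m)).measurableSet) hanti
    ⟨0, (integrableOn_speed h hT).mono_set sdiff_subset⟩
  have hemp : ⋂ m, (Icc 0 T \ regularTimes T φ (δ m)) = ∅ := by
    refine eq_empty_of_forall_notMem fun t ht => ?_
    rw [mem_iInter] at ht
    obtain ⟨d, hd, hdt⟩ := exists_mem_regularTimes hφo (ht 0).1
    obtain ⟨m, hm⟩ := (hlim.eventually (gt_mem_nhds hd)).exists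
    exact (ht m).2 (regularTimes_anti hm.le hdt)
  rw [hemp, setIntegral_empty] at key
  obtain ⟨m, h1, h2⟩ := ((key.eventually (gt_mem_nhds hε)).and
    (hlim.eventually (gt_mem_nhds hε))).exists
  exact ⟨δ m, hδ0 m, h2, h1⟩

theorem exists_setIntegral_speed_lt (h : AbsolutelyContinuousOnInterval φ 0 T) (hT : 0 ≤ T)
    {ε : ℝ} (hε : 0 < ε) : ∃ η, 0 < η ∧ ∀ a b, 0 ≤ a → a ≤ b → b ≤ T → b - a < η →
      ∫ t in Ioc a b, speed φ t < ε := by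
  have hint := integrableOn_speed h hT
  have hnn : ∀ t, 0 ≤ speed φ t := fun t => zero_le_one.trans (one_le_speed t)
  obtain ⟨η, hη, key⟩ := exists_pos_setLIntegral_lt_of_measure_lt
    (μ := volume.restrict (Icc 0 T)) (f := fun t => ENNReal.ofReal (speed φ t))
    (by
      rw [← ofReal_integral_eq_lintegral_ofReal hint (ae_of_all _ hnn)]
      exact ENNReal.ofReal_ne_top) (ENNReal.ofReal_pos.2 hε).ne'
  obtain ⟨η', hη', hlt⟩ := ENNReal.lt_iff_exists_nnreal_btwn.1 hη
  refine ⟨η', by exact_mod_cast hη', fun a b ha hab hb hη2 => ?_⟩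
  have hsub : Ioc a b ⊆ Icc 0 T := fun t ht => ⟨ha.trans ht.1.le, ht.2.trans hb⟩
  have h1 := key (Ioc a b) (by
    refine lt_of_le_of_lt (Measure.restrict_apply_le _ _) ?_
    rw [Real.volume_Ioc]
    refine lt_trans ?_ hlt
    rw [← ENNReal.ofReal_coe_nnreal]
    exact (ENNReal.ofReal_lt_ofReal_iff (by exact_mod_cast hη')).2 hη2)
  rw [Measure.restrict_restrict measurableSet_Ioc, inter_eq_left.2 hsub,
    ← ofReal_integral_eq_lintegral_ofReal (hint.mono_set hsub) (ae_of_all _ hnn)] at h1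
  exact (ENNReal.ofReal_lt_ofReal_iff hε).1 h1

end

/-! ### The upper bound -/

section

variable {N : ℕ} {L : Set (Fin N) → Vec N → ℝ≥0∞} {T : ℝ} {φ : ℝ → Vec N}
  {Ω : Type*} [MeasurableSpace Ω] {M : MarkovFamily N Ω}

/-- The exponential upper bound with rate `c` for tubes around `φ` on the time interval `[a, b]`. -/
def TubeUpperRate (M : MarkovFamily N Ω) (φ : ℝ → Vec N) (a b c : ℝ) : Prop :=
  M.UpperRate (φ a) (M.tube (b - a) fun t => φ (a + t)) c

theorem tubeUpperRate_zero (a b : ℝ) : TubeUpperRate M φ a b 0 := MarkovFamily.upperRate_zero _ _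

theorem MarkovFamily.UpperRate.le {x : Vec N} {A : ℝ → ℕ → Set Ω} {c c' : ℝ}
    (h : M.UpperRate x A c') (hc : c ≤ c') : M.UpperRate x A c := by
  obtain ⟨δ, hδ, h⟩ := h
  refine ⟨δ, hδ, h.mono fun n hn y hy => (hn y hy).trans ?_⟩
  gcongr

theorem TubeUpperRate.add (hφ : ContinuousOn φ (Icc 0 T)) {a b d c c' : ℝ} (ha : 0 ≤ a)
    (hab : a ≤ b) (hbd : b ≤ d) (hd : d ≤ T) (h : TubeUpperRate M φ a b c)
    (h' : TubeUpperRate M φ b d c') : TubeUpperRate M φ a d (c + c') := by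
  obtain ⟨S, hS⟩ : ∃ S : ℝ≥0, (S : ℝ) = b - a := ⟨⟨b - a, sub_nonneg.2 hab⟩, rfl⟩
  obtain ⟨R, hR⟩ : ∃ R : ℝ≥0, (R : ℝ) = d - b := ⟨⟨d - b, sub_nonneg.2 hbd⟩, rfl⟩
  have hSR : d - a = S + R := by rw [hS, hR]; ring
  unfold TubeUpperRate at h h' ⊢
  rw [hSR]
  rw [← hS] at h
  rw [← hR] at h'
  have hSa : a + S = b := by rw [hS]; ring
  have key := MarkovFamily.UpperRate.add (M := M) (S := S) (T := R) (φ := fun t => φ (a + t))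
    (c := c) (c' := c') (hφ.comp (by fun_prop) fun t ht =>
      ⟨by linarith [ht.1], by linarith [ht.2]⟩)
    (by simpa using h) (by simpa [← add_assoc, hSa] using h')
  simpa using key

/-- A zero summand has no smaller nonnegative rate, hence the alternatives with rate zero. -/
theorem exists_nnreal_le_add {a b : ℝ≥0∞} {c : ℝ≥0} (h : c < a + b) :
    ∃ c₁ c₂ : ℝ≥0, (c₁ < a ∨ c₁ = 0) ∧ (c₂ < b ∨ c₂ = 0) ∧ c ≤ c₁ + c₂ := by
  rcases eq_or_ne a 0 with rfl | ha
  · exact ⟨0, c, Or.inr rfl, Or.inl (by simpa using h), by simp⟩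
  rcases eq_or_ne b 0 with rfl | hb
  · exact ⟨c, 0, Or.inl (by simpa using h), Or.inr rfl, by simp⟩
  obtain ⟨y, hy, z, hz, hyz⟩ := ENNReal.exists_lt_add_of_lt_add h ha hb
  lift y to ℝ≥0 using hy.ne_top
  lift z to ℝ≥0 using hz.ne_top
  exact ⟨y, z, Or.inl hy, Or.inl hz, by exact_mod_cast hyz.le⟩

/-- Upper bounds at all the rates below a threshold add up over adjacent intervals. -/
theorem tubeUpperRate_add_of_lt (hφ : ContinuousOn φ (Icc 0 T)) {a b d : ℝ} {e e' : ℝ≥0∞}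
    (ha : 0 ≤ a) (hab : a ≤ b) (hbd : b ≤ d) (hd : d ≤ T)
    (h : ∀ c : ℝ≥0, c < e → TubeUpperRate M φ a b c)
    (h' : ∀ c : ℝ≥0, c < e' → TubeUpperRate M φ b d c) {c : ℝ≥0} (hc : c < e + e') :
    TubeUpperRate M φ a d c := by
  obtain ⟨c₁, c₂, h1, h2, h12⟩ := exists_nnreal_le_add hc
  have k1 : TubeUpperRate M φ a b c₁ := by
    rcases h1 with h1 | rfl
    · exact h c₁ h1
    · exact tubeUpperRate_zero a b
  have k2 : TubeUpperRate M φ b d c₂ := by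
    rcases h2 with h2 | rfl
    · exact h' c₂ h2
    · exact tubeUpperRate_zero b d
  exact (k1.add hφ ha hab hbd hd k2).le (by exact_mod_cast h12)

/-- A tube narrower than `δ` avoids the walls of the face, so staying in it implies the event in
(A₃). -/
theorem tubeUpperRate_of_face (hA3 : M.A3 L) {a b δ : ℝ} (hab : a < b) (hδ : 0 < δ)
    {Λ : Set (Fin N)} (ha : φ a ∈ face Λ) (hb : φ b ∈ face Λ)
    (hΛ : ∀ t ∈ Icc a b, ∀ i ∈ Λ, δ ≤ φ t i) {c : ℝ≥0}
    (hc : c < ENNReal.ofReal (b - a) * L Λ ((b - a)⁻¹ • (φ b - φ a))) :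
    TubeUpperRate M φ a b c := by
  obtain ⟨δ', hδ', h⟩ := hA3.upperRate (sub_pos.2 hab) ha hb hc
  refine ⟨min δ δ', lt_min hδ hδ', h.mono fun n hn y hy =>
    (measure_mono ?_).trans (hn y (hy.trans_le (min_le_right _ _)))⟩
  have h1 := MarkovFamily.tube_subset_endEvent (M := M) (sub_nonneg.2 hab.le)
    (φ := fun t => φ (a + t)) (Λ := Λ) (δ := min δ δ') (fun t ht i hi => (min_le_left _ _).trans
      (hΛ (a + t) ⟨by linarith [ht.1], by linarith [ht.2]⟩ i hi)) n
  refine h1.trans fun ω hω => ?_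
  rw [add_sub_cancel] at hω
  exact ⟨hω.1.trans_le (min_le_right _ _), hω.2⟩

/-- A difference quotient of `φ` over a short interval around `t` with endpoints in the face of
`φ t` has a cost of at most `e`. -/
def QuotientCostLE (L : Set (Fin N) → Vec N → ℝ≥0∞) (φ : ℝ → Vec N) (η t : ℝ) (e : ℝ≥0∞) : Prop :=
  ∃ s₀ s₁, s₀ < s₁ ∧ s₀ ≤ t ∧ t ≤ s₁ ∧ s₁ - s₀ ≤ η ∧
    (∀ i ∉ posSet (φ t), φ s₀ i = 0 ∧ φ s₁ i = 0) ∧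
    L (posSet (φ t)) ((s₁ - s₀)⁻¹ • (φ s₁ - φ s₀)) ≤ e

/-- (A₃) is used between the first and the last regular time `t₀ ≤ t₁` of the cell, and rate zero
elsewhere. The step function lives on `Ioc t₀ t₁`, so `t₀` is an exception; if `t₀ = t₁` it is the
only regular time. -/
theorem exists_piece_upper (hA3 : M.A3 L) (hφ : ContinuousOn φ (Icc 0 T))
    (hφo : ∀ t ∈ Icc 0 T, φ t ∈ orthant N) {δ η a b : ℝ} (hδ : 0 < δ) (ha : 0 ≤ a)
    (hb : b ≤ T) (hη : b - a ≤ η) (hosc : ∀ s ∈ Icc a b, ∀ t ∈ Icc a b, ‖φ s - φ t‖ ≤ δ / 2) :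
    ∃ (f : ℝ → ℝ≥0∞) (t₀ : ℝ), Measurable f ∧
      (∀ c : ℝ≥0, c < ∫⁻ t, f t → TubeUpperRate M φ a b c) ∧
      ∀ t ∈ regularTimes T φ δ ∩ Icc a b, t ≠ t₀ → QuotientCostLE L φ η t (f t) := by
  rcases (regularTimes T φ δ ∩ Icc a b).eq_empty_or_nonempty with hemp | hne
  · refine ⟨0, 0, measurable_const, fun c hc => ?_, fun t ht => by simp [hemp] at ht⟩
    simp at hc
  have hcpt : IsCompact (regularTimes T φ δ ∩ Icc a b) :=
    isCompact_Icc.inter_left (isClosed_regularTimes hφ δ)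
  obtain ⟨t₀, ht₀, hleast⟩ := hcpt.exists_isLeast hne
  obtain ⟨t₁, ht₁, hgreatest⟩ := hcpt.exists_isGreatest hne
  have h01 : t₀ ≤ t₁ := hleast ht₁
  have hface : ∀ t ∈ regularTimes T φ δ ∩ Icc a b, φ t ∈ face (posSet (φ t₀)) := fun t ht =>
    ⟨hφo t ht.1.1, posSet_eq_of_mem_regularTimes ht.1 ht₀.1
      ((hosc t ht.2 t₀ ht₀.2).trans_lt (half_lt_self hδ))⟩
  refine ⟨(Ioc t₀ t₁).indicator fun _ =>
    L (posSet (φ t₀)) ((t₁ - t₀)⁻¹ • (φ t₁ - φ t₀)), t₀,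
    measurable_const.indicator measurableSet_Ioc, fun c hc => ?_, fun t ht hne => ?_⟩
  · rw [lintegral_indicator measurableSet_Ioc, setLIntegral_const, Real.volume_Ioc, mul_comm] at hc
    have hlt : t₀ < t₁ := by
      refine h01.lt_of_ne fun h => ?_
      simp [h] at hc
    have hmid := tubeUpperRate_of_face (M := M) hA3 hlt (half_pos hδ) (hface t₀ ht₀) (hface t₁ ht₁)
      (fun t ht i hi => by
        have h1 := le_of_mem_regularTimes ht₀.1 hi
        have h2 := (PiLp.norm_apply_le (φ t₀ - φ t) i).trans
          (hosc t₀ ht₀.2 t ⟨ht₀.2.1.trans ht.1, ht.2.trans ht₁.2.2⟩)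
        rw [Real.norm_eq_abs, PiLp.sub_apply] at h2
        linarith [(abs_le.1 h2).2]) hc
    have hl := (tubeUpperRate_zero a t₀).add hφ ha ht₀.2.1 h01 (ht₁.2.2.trans hb) hmid
    have hr := hl.add hφ ha (ht₀.2.1.trans h01) ht₁.2.2 hb (tubeUpperRate_zero t₁ b)
    simpa using hr
  · have hlt : t₀ < t := (hleast ht).lt_of_ne hne.symm
    have hle : t ≤ t₁ := hgreatest ht
    rw [indicator_of_mem (show t ∈ Ioc t₀ t₁ from ⟨hlt, hle⟩)]
    have hΛ := (hface t ht).2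
    refine ⟨t₀, t₁, hlt.trans_le hle, hlt.le, hle, by linarith [ht₀.2.1, ht₁.2.2], fun i hi => ?_,
      by rw [hΛ]⟩
    rw [hΛ] at hi
    exact ⟨(mem_face_iff.1 (hface t₀ ht₀)).2 i hi, (mem_face_iff.1 (hface t₁ ht₁)).2 i hi⟩

theorem exists_step_upper (hA3 : M.A3 L) (hφ : ContinuousOn φ (Icc 0 T))
    (hφo : ∀ t ∈ Icc 0 T, φ t ∈ orthant N) {δ η : ℝ} (hδ : 0 < δ) (hη : 0 ≤ η)
    (hosc : ∀ s ∈ Icc 0 T, ∀ t ∈ Icc 0 T, |s - t| ≤ η → ‖φ s - φ t‖ ≤ δ / 2) (k : ℕ)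
    (hk : k * η ≤ T) :
    ∃ (f : ℝ → ℝ≥0∞) (Q : Set ℝ), Measurable f ∧ Q.Countable ∧
      (∀ c : ℝ≥0, c < ∫⁻ t, f t → TubeUpperRate M φ 0 (k * η) c) ∧
      ∀ t ∈ regularTimes T φ δ ∩ Icc 0 (k * η), t ∉ Q → QuotientCostLE L φ η t (f t) := by
  induction k with
  | zero =>
    refine ⟨0, {0}, measurable_const, countable_singleton 0, fun c hc => by simp at hc, ?_⟩
    intro t ht hne
    simp only [Nat.cast_zero, zero_mul, Icc_self] at ht
    exact absurd ht.2 hne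
  | succ k ih =>
    have hk0 : 0 ≤ k * η := by positivity
    have hk1 : ((k + 1 : ℕ) : ℝ) * η = k * η + η := by push_cast; ring
    rw [hk1] at hk ⊢
    obtain ⟨f, Q, hf, hQ, hU, hfQ⟩ := ih (by linarith)
    obtain ⟨g, t₀, hg, hU', hgt⟩ := exists_piece_upper (M := M) (L := L) hA3 hφ hφo hδ hk0 hk (η := η) (by linarith) fun s hs t ht =>
        hosc s ⟨hk0.trans hs.1, hs.2.trans hk⟩ t ⟨hk0.trans ht.1, ht.2.trans hk⟩
        (abs_sub_le_iff.2 ⟨by linarith [hs.2, ht.1], by linarith [hs.1, ht.2]⟩)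
    -- Adding nonnegative functions preserves the upper bounds already obtained for the quotient
    -- costs.
    refine ⟨f + g, insert t₀ Q, hf.add hg, hQ.insert t₀, fun c hc => ?_, fun t ht hne => ?_⟩
    · simp only [Pi.add_apply] at hc
      rw [lintegral_add_left hf] at hc
      exact tubeUpperRate_add_of_lt hφ le_rfl hk0 (by linarith) hk hU hU' hc
    · rw [mem_insert_iff, not_or] at hne
      rcases le_total t (k * η) with h | h
      · obtain ⟨s₀, s₁, h1, h2, h3, h4, h5, h6⟩ := hfQ t ⟨ht.1, ht.2.1, h⟩ hne.2
        exact ⟨s₀, s₁, h1, h2, h3, h4, h5, h6.trans (by simp)⟩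
      · obtain ⟨s₀, s₁, h1, h2, h3, h4, h5, h6⟩ := hgt t ⟨ht.1, h, ht.2.2⟩ hne.1
        exact ⟨s₀, s₁, h1, h2, h3, h4, h5, h6.trans (by simp)⟩

/-- Straddling difference quotients converge to the derivative. -/
theorem eventually_straddle {v : Vec N} {t : ℝ} (h : HasDerivAt φ v t) {ε : ℝ} (hε : 0 < ε) :
    ∃ η, 0 < η ∧ ∀ s₀ s₁, s₀ < s₁ → s₀ ≤ t → t ≤ s₁ → s₁ - s₀ < η →
      ‖(s₁ - s₀)⁻¹ • (φ s₁ - φ s₀) - v‖ < ε := by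
  obtain ⟨η, hη, hb⟩ := Metric.eventually_nhds_iff.1
    ((hasDerivAt_iff_isLittleO.1 h).def (half_pos hε))
  refine ⟨η, hη, fun s₀ s₁ h01 h0 h1 hlt => ?_⟩
  have hd : 0 < s₁ - s₀ := sub_pos.2 h01
  have e0 := hb (y := s₀) (by rw [Real.dist_eq, abs_of_nonpos (by linarith)]; linarith)
  have e1 := hb (y := s₁) (by rw [Real.dist_eq, abs_of_nonneg (by linarith)]; linarith)
  rw [Real.norm_eq_abs, abs_of_nonpos (by linarith)] at e0
  rw [Real.norm_eq_abs, abs_of_nonneg (by linarith)] at e1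
  have : (s₁ - s₀)⁻¹ • (φ s₁ - φ s₀) - v = (s₁ - s₀)⁻¹ •
      ((φ s₁ - φ t - (s₁ - t) • v) - (φ s₀ - φ t - (s₀ - t) • v)) := by
    have : (φ s₁ - φ t - (s₁ - t) • v) - (φ s₀ - φ t - (s₀ - t) • v) =
        (φ s₁ - φ s₀) - (s₁ - s₀) • v := by module
    rw [this, smul_sub (s₁ - s₀)⁻¹ (φ s₁ - φ s₀), smul_smul, inv_mul_cancel₀ hd.ne', one_smul]
  rw [this, norm_smul, norm_inv, Real.norm_eq_abs, abs_of_pos hd, inv_mul_lt_iff₀ hd]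
  refine (norm_sub_le _ _).trans_lt ?_
  nlinarith

/-- As the mesh tends to zero the straddling quotients converge to `deriv φ t`. Semicontinuity
bounds the cost of the derivative by the lower limit of the step functions, and Fatou's lemma
selects a mesh whose total rate exceeds `c`. -/
theorem tubeUpperRate_regularTimes (hdense : M.DenseStates) (hA1 : M.A1 L) (hA3 : M.A3 L)
    (hT : 0 < T) (hφo : ∀ t ∈ Icc 0 T, φ t ∈ orthant N)
    (hac : AbsolutelyContinuousOnInterval φ 0 T) {δ : ℝ} (hδ : 0 < δ) {c : ℝ≥0}
    (hc : c < ∫⁻ t in regularTimes T φ δ, L (posSet (φ t)) (deriv φ t)) :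
    TubeUpperRate M φ 0 T c := by
  have huc := hac.uniformContinuousOn
  rw [uIcc_of_le hT.le] at huc
  have hφ := huc.continuousOn
  rw [Metric.uniformContinuousOn_iff] at huc
  obtain ⟨η₀, hη₀, hmod⟩ := huc (δ / 2) (half_pos hδ)
  -- Starting the sequence of meshes at `m₀` makes each of them fine enough for the oscillation
  -- bound `δ / 2`.
  obtain ⟨m₀, hm₀⟩ := exists_nat_gt (T / η₀)
  have hstep : ∀ m : ℕ, ∃ (f : ℝ → ℝ≥0∞) (Q : Set ℝ), Measurable f ∧ Q.Countable ∧
      (∀ c : ℝ≥0, c < ∫⁻ t, f t → TubeUpperRate M φ 0 T c) ∧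
      ∀ t ∈ regularTimes T φ δ, t ∉ Q → QuotientCostLE L φ (T / (m₀ + m + 1 : ℕ)) t (f t) := by
    intro m
    have hpos : (0 : ℝ) < (m₀ + m + 1 : ℕ) := by positivity
    have hmul : ((m₀ + m + 1 : ℕ) : ℝ) * (T / (m₀ + m + 1 : ℕ)) = T := by field_simp
    have hlt : T / (m₀ + m + 1 : ℕ) < η₀ := by
      rw [div_lt_iff₀ hpos]
      rw [div_lt_iff₀ hη₀] at hm₀
      push_cast
      nlinarith [(Nat.cast_nonneg m : (0 : ℝ) ≤ m)]
    obtain ⟨f, Q, h1, h2, h3, h4⟩ := exists_step_upper (M := M) hA3 hφ hφo hδ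
      (η := T / (m₀ + m + 1 : ℕ)) (by positivity) (fun s hs t ht hst => by
        rw [← dist_eq_norm]
        exact (hmod s hs t ht (by rw [Real.dist_eq]; linarith)).le) (m₀ + m + 1) hmul.le
    rw [hmul] at h3 h4
    exact ⟨f, Q, h1, h2, h3, fun t ht => h4 t ⟨ht, ht.1⟩⟩
  choose f Q hf hQ hU hfQ using hstep
  have hmeas := (isClosed_regularTimes hφ δ).measurableSet
  have hle : ∀ᵐ t, t ∈ regularTimes T φ δ →
      L (posSet (φ t)) (deriv φ t) ≤ liminf (fun m => f m t) atTop := by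
    filter_upwards [ae_deriv_eq_zero_of_face hac hT.le hφo,
      (countable_iUnion hQ).ae_notMem volume] with t ht htQ htr
    obtain ⟨hder, hzero⟩ := ht htr.1
    simp only [mem_iUnion, not_exists] at htQ
    refine le_of_forall_lt fun c hc => ?_
    obtain ⟨c', hcc', hc'⟩ := ENNReal.lt_iff_exists_nnreal_btwn.1 hc
    obtain ⟨ε, hε, hcost⟩ := exists_le_cost hdense hA1 hA3 hzero hc'
    obtain ⟨η, hη, hstr⟩ := eventually_straddle hder hε
    refine hcc'.trans_le (le_liminf_of_le (by isBoundedDefault) ?_)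
    have hlim : Tendsto (fun m : ℕ => T / ((m₀ + m + 1 : ℕ) : ℝ)) atTop (𝓝 0) := by
      refine (tendsto_const_div_atTop_nhds_zero_nat T).comp
        (f := fun m : ℕ => m₀ + m + 1) ?_
      exact tendsto_atTop_mono (fun m => by simp only [id]; omega) tendsto_id
    filter_upwards [hlim.eventually (gt_mem_nhds hη)] with m hm
    obtain ⟨s₀, s₁, k1, k2, k3, k4, k5, k6⟩ := hfQ m t htr (htQ m)
    refine (hcost _ subset_rfl _ (fun i hi => ?_) (hstr s₀ s₁ k1 k2 k3 (k4.trans_lt hm))).trans k6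
    simp [(k5 i hi).1, (k5 i hi).2]
  have hF : ∫⁻ t in regularTimes T φ δ, L (posSet (φ t)) (deriv φ t) ≤
      liminf (fun m => ∫⁻ t, f m t) atTop := by
    refine le_trans ?_ (lintegral_liminf_le hf)
    refine le_trans ?_ (setLIntegral_le_lintegral (regularTimes T φ δ) _)
    exact setLIntegral_mono_ae (Measurable.liminf hf).aemeasurable hle
  obtain ⟨m, hm⟩ := (eventually_lt_of_lt_liminf (hc.trans_le hF)).exists
  exact hU m c hm

/-- The local upper bound. -/
theorem W_le_neg_action (hdense : M.DenseStates) (hA1 : M.A1 L) (hA3 : M.A3 L)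
    (hT : 0 < T) (hφo : ∀ t ∈ Icc 0 T, φ t ∈ orthant N)
    (hac : AbsolutelyContinuousOnInterval φ 0 T) : M.W T φ ≤ -(action L T φ : EReal) := by
  refine MarkovFamily.upperExponent_le_neg fun c hc => ?_
  set δ : ℕ → ℝ := fun m => 1 / ((m : ℝ) + 1) with hδ
  have hδ0 : ∀ m, 0 < δ m := fun m => by positivity
  have hδa : Antitone δ := fun m m' hm => by
    simp only [hδ]; gcongr
  have hlim : Tendsto δ atTop (𝓝 0) := tendsto_one_div_add_atTop_nhds_zero_nat
  have hun : Icc 0 T = ⋃ m, regularTimes T φ (δ m) := by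
    ext t
    rw [mem_iUnion]
    refine ⟨fun ht => ?_, fun ⟨m, hm⟩ => hm.1⟩
    obtain ⟨d, hd, hdt⟩ := exists_mem_regularTimes hφo ht
    obtain ⟨m, hm⟩ := (hlim.eventually (gt_mem_nhds hd)).exists
    exact ⟨m, regularTimes_anti hm.le hdt⟩
  have hdir : Directed (· ⊆ ·) fun m => regularTimes T φ (δ m) :=
    directed_of_isDirected_le fun m m' hm => regularTimes_anti (hδa hm)
  -- The regular sets increase to the whole interval, so the rate `c` is already exceeded on one of
  -- them.
  rw [action, hun, setLIntegral_iUnion_of_directed _ hdir, lt_iSup_iff] at hc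
  obtain ⟨m, hm⟩ := hc
  have := tubeUpperRate_regularTimes hdense hA1 hA3 hT hφo hac (hδ0 m) hm
  simpa [TubeUpperRate] using this

end

/-! ### Piecewise linear approximation and the main theorem -/

section

variable {N : ℕ} {L : Set (Fin N) → Vec N → ℝ≥0∞} {T : ℝ} {φ : ℝ → Vec N}
  {Ω : Type*} [MeasurableSpace Ω] {M : MarkovFamily N Ω}

/-- On a short interval, a path can be replaced by a piecewise linear one, up to an error that is
controlled by the irregular times. -/
theorem exists_connected_piece (hdense : M.DenseStates) (hconv : ∀ Λ, ConvexOn ℝ≥0 univ (L Λ))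
    (hA1 : M.A1 L) (hA3 : M.A3 L) {K : ℝ} (hK : ConnectingConst L K)
    (hφo : ∀ t ∈ Icc 0 T, φ t ∈ orthant N) (hac : AbsolutelyContinuousOnInterval φ 0 T)
    {δ a b : ℝ} (hδ : 0 < δ) (ha : 0 ≤ a) (hab : a ≤ b) (hb : b ≤ T)
    (hosc : ∫ t in Ioc a b, speed φ t ≤ δ / 2) {g : ℝ}
    (hg : g = ∫ t in Ioc a b \ regularTimes T φ δ, speed φ t) :
    ∃ σ, |σ - (b - a)| ≤ 4 * K * g ∧
      Connected L (orthant N ∩ Metric.closedBall (φ a) (2 * K * δ)) (φ a) (φ b) σ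
        (actionOn L a b φ + ENNReal.ofReal (4 * K * g)) := by
  obtain ⟨hK1, hK⟩ := hK
  have hT : 0 ≤ T := ha.trans (hab.trans hb)
  have hφ : ContinuousOn φ (Icc 0 T) := by simpa [uIcc_of_le hT] using hac.continuousOn
  have hmeas := (isClosed_regularTimes hφ δ).measurableSet
  have hsub : Ioc a b ⊆ Icc 0 T := fun t ht => ⟨ha.trans ht.1.le, ht.2.trans hb⟩
  have hint : IntegrableOn (speed φ) (Ioc a b) := (integrableOn_speed hac hT).mono_set hsub
  have hdint : IntegrableOn (deriv φ) (Ioc a b) := (integrableOn_deriv hac hT).mono_set hsub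
  have hgint := hint.mono_set (sdiff_subset (s := Ioc a b) (t := regularTimes T φ δ))
  have hg0 : 0 ≤ g := hg ▸ integral_nonneg fun t => zero_le_one.trans (one_le_speed t)
  have hgδ : g ≤ δ / 2 := hg ▸ (setIntegral_speed_mono hint sdiff_subset.eventuallyLE).trans hosc
  have hincr : ∀ s t, a ≤ s → s ≤ t → t ≤ b → ‖φ t - φ s‖ ≤ ∫ u in Ioc s t, speed φ u := by
    intro s t hs hst ht
    rw [← integral_deriv_eq hac (ha.trans hs) hst (ht.trans hb)]
    exact norm_setIntegral_deriv_le (hint.mono_set (Ioc_subset_Ioc hs ht))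
  have hinc : ∀ s t, a ≤ s → s ≤ t → t ≤ b → ‖φ t - φ s‖ ≤ δ / 2 := fun s t hs hst ht =>
    (hincr s t hs hst ht).trans ((setIntegral_speed_mono hint
      (Ioc_subset_Ioc hs ht).eventuallyLE).trans hosc)
  set S := orthant N ∩ Metric.closedBall (φ a) (2 * K * δ) with hS
  have hSconv : Convex ℝ S := (convex_orthant N).inter (convex_closedBall _ _)
  have hmemS : ∀ x ∈ orthant N, ‖x - φ a‖ ≤ δ → x ∈ S := fun x hx h =>
    ⟨hx, by rw [Metric.mem_closedBall, dist_eq_norm]; nlinarith⟩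
  have hao := hφo a ⟨ha, hab.trans hb⟩
  have hbo := hφo b ⟨ha.trans hab, hb⟩
  have haS : φ a ∈ S := hmemS _ hao (by simpa using hδ.le)
  have hbS : φ b ∈ S := hmemS _ hbo ((hinc a b le_rfl hab le_rfl).trans (by linarith))
  have hvolA : (volume (Ioc a b ∩ regularTimes T φ δ)).toReal +
      (volume (Ioc a b \ regularTimes T φ δ)).toReal = b - a := by
    have := measureReal_inter_add_sdiff (μ := volume) (s := Ioc a b) hmeas
      (by simp)
    simpa [measureReal_def, sub_nonneg.2 hab] using this
  have hvolG := volume_le_setIntegral_speed hgint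
  rw [← hg] at hvolG
  -- If almost all of the cell is irregular, `g` bounds its length and displacement, and a direct
  -- connection suffices.
  by_cases hnull : volume (Ioc a b ∩ regularTimes T φ δ) = 0
  · have hae : Ioc a b ≤ᵐ[volume] (Ioc a b \ regularTimes T φ δ : Set ℝ) := by
      filter_upwards [measure_eq_zero_iff_ae_notMem.1 hnull] with t ht htab
      exact ⟨htab, fun h => ht ⟨htab, h⟩⟩
    have hba : ‖φ b - φ a‖ ≤ g := hg ▸
      (hincr a b le_rfl hab le_rfl).trans (setIntegral_speed_mono hgint hae)
    obtain ⟨σ, hσ, hc⟩ := hK S hSconv inter_subset_left (φ a) haS (φ b) hbS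
      (inter_subset_inter_right _ (Metric.closedBall_subset_closedBall (by nlinarith)))
    refine ⟨σ, ?_, hc.mono (le_add_left (ENNReal.ofReal_le_ofReal (by nlinarith)))⟩
    rw [hnull, ENNReal.toReal_zero, zero_add] at hvolA
    have := hc.nonneg
    rw [abs_le]
    constructor <;> nlinarith
  have hcpt : IsCompact (regularTimes T φ δ ∩ Icc a b) :=
    isCompact_Icc.inter_left (isClosed_regularTimes hφ δ)
  obtain ⟨t₀, ht₀, hleast⟩ := hcpt.exists_isLeast (by
    by_contra hemp
    rw [not_nonempty_iff_eq_empty] at hemp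
    refine hnull (measure_mono_null (fun t ht => ?_) measure_empty)
    rw [← hemp]
    exact ⟨ht.2, Ioc_subset_Icc_self ht.1⟩)
  set Λ := posSet (φ t₀) with hΛ
  set A := Ioc a b ∩ regularTimes T φ δ with hA
  have hAm : MeasurableSet A := measurableSet_Ioc.inter hmeas
  have hAΛ : ∀ t ∈ A, posSet (φ t) = Λ := fun t ht => by
    refine posSet_eq_of_mem_regularTimes ht.2 ht₀.1 (lt_of_le_of_lt ?_ (half_lt_self hδ))
    exact hinc t₀ t ht₀.2.1 (hleast ⟨ht.2, Ioc_subset_Icc_self ht.1⟩) ht.1.2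
  have hAtop : volume A ≠ ⊤ := ((measure_mono inter_subset_left).trans_lt (by simp)).ne
  set D := ∫ t in A, deriv φ t with hD
  have hAd : IntegrableOn (deriv φ) A := hdint.mono_set inter_subset_left
  have hzero : ∀ᵐ t, t ∈ A → ∀ i ∉ Λ, deriv φ t i = 0 := by
    filter_upwards [ae_deriv_eq_zero_of_face hac hT hφo] with t ht htA i hi
    exact (ht htA.2.1).2 i (by rwa [hAΛ t htA])
  have hDΛ : ∀ i ∉ Λ, D i = 0 := by
    intro i hi
    rw [hD, eval_integral_piLp fun i => hAd.eval_piLp i]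
    refine setIntegral_eq_zero_of_ae_eq_zero ?_
    filter_upwards [hzero] with t ht htA using ht htA i hi
  have hDδ : ‖D‖ ≤ δ / 2 := (norm_setIntegral_deriv_le (hint.mono_set inter_subset_left)).trans
    ((setIntegral_speed_mono hint inter_subset_left.eventuallyLE).trans hosc)
  -- All times before the first regular one are irregular.
  have hp : ‖φ t₀ - φ a‖ ≤ g := by
    refine (hincr a t₀ le_rfl ht₀.2.1 ht₀.2.2).trans (hg ▸ setIntegral_speed_mono hgint ?_)
    filter_upwards [Measure.ae_ne volume t₀] with t hne ht
    exact ⟨⟨ht.1, ht.2.trans ht₀.2.2⟩, fun h =>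
      hne (le_antisymm ht.2 (hleast ⟨h, ht.1.le, ht.2.trans ht₀.2.2⟩))⟩
  have hq : ‖φ b - (φ t₀ + D)‖ ≤ 2 * g := by
    have h1 := integral_inter_add_sdiff (μ := volume) (f := deriv φ) (s := Ioc a b) hmeas hdint
    rw [integral_deriv_eq hac ha hab hb] at h1
    have h2 : φ b - (φ t₀ + D) =
        (∫ t in Ioc a b \ regularTimes T φ δ, deriv φ t) - (φ t₀ - φ a) := by
      rw [sub_eq_iff_eq_add.1 h1.symm]
      abel
    rw [h2]
    refine (norm_sub_le _ _).trans ?_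
    have := norm_setIntegral_deriv_le hgint
    linarith
  -- `D` is tangent to the face and at most `δ / 2`, while the positive coordinates of `φ t₀` are at
  -- least `δ`.
  have hqface : φ t₀ + D ∈ face Λ := by
    refine mem_face_iff.2 ⟨fun i hi => ?_, fun i hi => ?_⟩
    · have h1 := le_of_mem_regularTimes ht₀.1 hi
      have h2 := (PiLp.norm_apply_le D i).trans hDδ
      rw [Real.norm_eq_abs] at h2
      rw [PiLp.add_apply]
      linarith [(abs_le.1 h2).1]
    · rw [PiLp.add_apply, hDΛ i hi, add_zero]
      exact le_antisymm (not_lt.1 hi) (hφo t₀ ht₀.1.1 i)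
  have hpS : φ t₀ ∈ S := hmemS _ (hφo t₀ ht₀.1.1) (by linarith)
  have hqa : ‖φ t₀ + D - φ a‖ ≤ δ := by
    have : φ t₀ + D - φ a = (φ t₀ - φ a) + D := by abel
    rw [this]
    exact (norm_add_le _ _).trans (by linarith)
  have hqS : φ t₀ + D ∈ S := hmemS _ hqface.1 hqa
  have hτ : 0 < (volume A).toReal := ENNReal.toReal_pos hnull hAtop
  obtain ⟨σ₁, hσ₁, hc₁⟩ := hK S hSconv inter_subset_left (φ a) haS (φ t₀) hpS
    (inter_subset_inter_right _ (Metric.closedBall_subset_closedBall (by nlinarith)))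
  have hc₂ := connected_segment (L := L) hSconv inter_subset_left hpS hqS hτ
  obtain ⟨σ₃, hσ₃, hc₃⟩ := hK S hSconv inter_subset_left _ hqS (φ b) hbS
    (inter_subset_inter_right _ (Metric.closedBall_subset_closedBall' (by
      rw [dist_eq_norm]; nlinarith)))
  rw [hqface.2, union_self, add_sub_cancel_left, ENNReal.ofReal_toReal hAtop] at hc₂
  have hjensen := mul_cost_average_le hdense hA1 hA3 (hconv Λ) hAm hnull hAtop hAd hzero
  have hact : ∫⁻ t in A, L Λ (deriv φ t) ≤ actionOn L a b φ := by
    rw [actionOn]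
    refine le_trans (le_of_eq ?_) (lintegral_mono_set (show A ⊆ Ioc a b from inter_subset_left))
    exact setLIntegral_congr_fun hAm fun t ht => by simp only [hAΛ t ht]
  have hσ₁0 := hc₁.nonneg
  have hσ₃0 := hc₃.nonneg
  have hσ₁' : σ₁ ≤ K * g := hσ₁.trans (by gcongr)
  have hσ₃' : σ₃ ≤ K * (2 * g) := hσ₃.trans (by gcongr)
  refine ⟨σ₁ + (volume A).toReal + σ₃, ?_, ((hc₁.trans hc₂).trans hc₃).mono ?_⟩
  · rw [abs_le]
    constructor <;> nlinarith [ENNReal.toReal_nonneg (a := volume (Ioc a b \ regularTimes T φ δ))]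
  · calc _ ≤ ENNReal.ofReal (K * g) + actionOn L a b φ + ENNReal.ofReal (K * (2 * g)) := by
          gcongr
          exact hjensen.trans hact
      _ = actionOn L a b φ + ENNReal.ofReal (K * g + K * (2 * g)) := by
          rw [ENNReal.ofReal_add (by positivity) (by positivity)]
          ring
      _ ≤ _ := by
          gcongr
          nlinarith

/-- The pieces do not last exactly as long as their cells, so the clock of `ψ` drifts. The `8 * K`
in `hmod` covers the drift accumulated before a cell and that inside it, each at most `4 * K` times
the irregular integral. -/
theorem exists_plPath_approx (hdense : M.DenseStates) (hconv : ∀ Λ, ConvexOn ℝ≥0 univ (L Λ))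
    (hA1 : M.A1 L) (hA3 : M.A3 L) {K : ℝ} (hK : ConnectingConst L K)
    (hφo : ∀ t ∈ Icc 0 T, φ t ∈ orthant N) (hac : AbsolutelyContinuousOnInterval φ 0 T)
    {δ η e : ℝ} (hδ : 0 < δ) (hη : 0 ≤ η)
    (hosc : ∀ a, 0 ≤ a → a + η ≤ T → ∫ t in Ioc a (a + η), speed φ t ≤ δ / 2)
    (hmod : ∀ s ∈ Icc 0 T, ∀ t ∈ Icc 0 T,
      |s - t| ≤ η + 8 * K * (∫ t in Icc 0 T \ regularTimes T φ δ, speed φ t) → ‖φ s - φ t‖ ≤ e)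
    (k : ℕ) (hk : k * η ≤ T) :
    ∃ (ψ : ℝ → Vec N) (σ : ℝ), PLPath ψ σ ∧ ψ 0 = φ 0 ∧ ψ σ = φ (k * η) ∧
      |σ - k * η| ≤ 4 * K * (∫ t in Ioc 0 (k * η) \ regularTimes T φ δ, speed φ t) ∧
      (∀ t ∈ Icc 0 σ, ψ t ∈ orthant N ∧ (t ∈ Icc 0 T → ‖ψ t - φ t‖ ≤ 2 * K * δ + e)) ∧
      actionOn L 0 σ ψ ≤ actionOn L 0 (k * η) φ +
        ENNReal.ofReal (4 * K * (∫ t in Ioc 0 (k * η) \ regularTimes T φ δ, speed φ t)) := by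
  have hK1 := hK.1
  have hT : 0 ≤ T := le_trans (by positivity) hk
  have hφ : ContinuousOn φ (Icc 0 T) := by simpa [uIcc_of_le hT] using hac.continuousOn
  have hmeas := (isClosed_regularTimes hφ δ).measurableSet
  have hint := (integrableOn_speed hac hT).mono_set
    (sdiff_subset (s := Icc 0 T) (t := regularTimes T φ δ))
  have hnn : ∀ A : Set ℝ, 0 ≤ ∫ t in A, speed φ t := fun A =>
    integral_nonneg fun t => zero_le_one.trans (one_le_speed t)
  have hsub : ∀ a b, 0 ≤ a → b ≤ T →
      Ioc a b \ regularTimes T φ δ ⊆ Icc 0 T \ regularTimes T φ δ := fun a b ha hb =>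
    sdiff_subset_sdiff_left fun t ht => ⟨ha.trans ht.1.le, ht.2.trans hb⟩
  have hle : ∀ a b, 0 ≤ a → b ≤ T → ∫ t in Ioc a b \ regularTimes T φ δ, speed φ t ≤
      ∫ t in Icc 0 T \ regularTimes T φ δ, speed φ t := fun a b ha hb =>
    setIntegral_speed_mono hint (hsub a b ha hb).eventuallyLE
  have he0 : 0 ≤ e := (norm_nonneg _).trans (hmod 0 ⟨le_rfl, hT⟩ 0 ⟨le_rfl, hT⟩ (by
    rw [sub_self, abs_zero]
    have := hnn (Icc 0 T \ regularTimes T φ δ)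
    positivity))
  induction k with
  | zero =>
    refine ⟨fun _ => φ 0, 0, .zero, rfl, by simp, by simp, fun t ht => ?_, by simp [actionOn]⟩
    obtain rfl : t = 0 := le_antisymm ht.2 ht.1
    exact ⟨hφo 0 ⟨le_rfl, hT⟩, fun _ => by simp; positivity⟩
  | succ k ih =>
    have hk0 : 0 ≤ k * η := by positivity
    have hk1 : ((k + 1 : ℕ) : ℝ) * η = k * η + η := by push_cast; ring
    rw [hk1] at hk ⊢
    obtain ⟨ψ, σ, h1, h2, h3, h4, h5, h6⟩ := ih (by linarith)
    obtain ⟨σ', hσ', χ, g1, g2, g3, g4, g5⟩ := exists_connected_piece hdense hconv hA1 hA3 hK hφo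
      hac hδ hk0 (by linarith : k * η ≤ k * η + η) hk (hosc _ hk0 hk) rfl
    have hsplit : ∫ t in Ioc 0 (k * η + η) \ regularTimes T φ δ, speed φ t =
        (∫ t in Ioc 0 (k * η) \ regularTimes T φ δ, speed φ t) +
          ∫ t in Ioc (k * η) (k * η + η) \ regularTimes T φ δ, speed φ t := by
      rw [← Ioc_union_Ioc_eq_Ioc hk0 (by linarith : k * η ≤ k * η + η), union_sdiff_distrib]
      refine setIntegral_union ?_ (measurableSet_Ioc.diff hmeas)
        (hint.mono_set (hsub _ _ le_rfl (by linarith))) (hint.mono_set (hsub _ _ hk0 hk))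
      exact (Ioc_disjoint_Ioc_of_le le_rfl).mono sdiff_subset sdiff_subset
    have hG1 := hle 0 (k * η) le_rfl (by linarith)
    have hG2 := hle (k * η) (k * η + η) hk0 hk
    have hn1 := hnn (Ioc 0 (k * η) \ regularTimes T φ δ)
    have hn2 := hnn (Ioc (k * η) (k * η + η) \ regularTimes T φ δ)
    rw [hsplit]
    set G₁ := ∫ t in Ioc 0 (k * η) \ regularTimes T φ δ, speed φ t
    set G₂ := ∫ t in Ioc (k * η) (k * η + η) \ regularTimes T φ δ, speed φ t
    set G := ∫ t in Icc 0 T \ regularTimes T φ δ, speed φ t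
    have he := h3.trans g2.symm
    rw [abs_le] at h4 hσ'
    have hKG1 : K * G₁ ≤ K * G := by gcongr
    have hKG2 : K * G₂ ≤ K * G := by gcongr
    refine ⟨append σ ψ χ, σ + σ', h1.append g1 he, (append_zero h1.nonneg).trans h2,
      (append_end g1.nonneg he).trans g3, ?_, ?_, ?_⟩
    · rw [abs_le]
      constructor <;> nlinarith
    · refine append_mem he (P := fun t x => x ∈ orthant N ∧
        (t ∈ Icc 0 T → ‖x - φ t‖ ≤ 2 * K * δ + e)) h5 fun t ht => ⟨(g4 t ht).1, fun htT => ?_⟩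
      have k1 := (g4 t ht).2
      rw [Metric.mem_closedBall, dist_eq_norm] at k1
      have k2 := hmod (k * η) ⟨hk0, by linarith⟩ (σ + t) htT (by
        rw [abs_le]
        constructor <;> nlinarith [ht.1, ht.2])
      have k3 := norm_add_le (χ t - φ (k * η)) (φ (k * η) - φ (σ + t))
      rw [sub_add_sub_cancel] at k3
      linarith
    · rw [actionOn_append h1.nonneg g1.nonneg he, ← actionOn_add hk0
        (by linarith : k * η ≤ k * η + η) φ, mul_add, ENNReal.ofReal_add (by positivity)
        (by positivity)]
      refine (add_le_add h6 g5).trans (le_of_eq ?_)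
      ring

theorem skorohodDist_lt_of_forall_le {ψ : ℝ → Vec N} {e δ : ℝ} (hδ : 0 < δ) (he : e < δ)
    (h : ∀ t ∈ Icc 0 T, ‖ψ t - φ t‖ ≤ e) : skorohodDist T φ ψ < ENNReal.ofReal δ := by
  refine lt_of_le_of_lt (iInf_le _ (OrderIso.refl _)) (lt_of_le_of_lt (max_le ?_ ?_)
    ((ENNReal.ofReal_lt_ofReal_iff hδ).2 he))
  · exact iSup_le fun t => by simp
  · refine iSup_le fun t => ?_
    rw [edist_dist, dist_comm, dist_eq_norm]
    exact ENNReal.ofReal_le_ofReal (h t t.2)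

/-- The approximating path lasts about `T`; it is followed by a rest at `φ T` and cut at `T`.
Resting has finite cost per unit of time, since `L Λ 0 ≤ L univ 0 < ⊤`. -/
theorem rateI_le_action (hdense : M.DenseStates) (hconv : ∀ Λ, ConvexOn ℝ≥0 univ (L Λ))
    (hA1 : M.A1 L) (hA2 : A2 L) (hA3 : M.A3 L) (hT : 0 < T)
    (hφo : ∀ t ∈ Icc 0 T, φ t ∈ orthant N) (hac : AbsolutelyContinuousOnInterval φ 0 T) :
    rateI L T φ ≤ action L T φ := by
  obtain ⟨K, hK⟩ := exists_connectingConst (hconv univ) hA2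
  have hK1 := hK.1
  obtain ⟨C, hC⟩ : ∃ C : ℝ≥0, L univ 0 = C :=
    ⟨(L univ 0).toNNReal, (ENNReal.coe_toNNReal hA2.self_of_nhds.ne).symm⟩
  have huc := hac.uniformContinuousOn
  rw [uIcc_of_le hT.le, Metric.uniformContinuousOn_iff] at huc
  refine iSup₂_le fun ε hε => ENNReal.le_of_forall_pos_le_add fun ε' hε' _ => ?_
  obtain ⟨η₀, hη₀, hmod⟩ := huc (ε / 4) (by positivity)
  have hε'0 : (0 : ℝ) < ε' := by exact_mod_cast hε'
  -- The three bounds serve the uniform distance, the clock drift, and the extra cost of the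
  -- connections and the final rest.
  obtain ⟨δ₀, hδ₀, hδε, hδη, hδε'⟩ : ∃ δ₀ : ℝ, 0 < δ₀ ∧ 2 * K * δ₀ ≤ ε / 4 ∧ 8 * K * δ₀ ≤ η₀ / 2 ∧
      4 * K * δ₀ * (1 + C) ≤ ε' := by
    have hm : 0 < min (min (ε / 4) (η₀ / 2)) ε' := by positivity
    refine ⟨min (min (ε / 4) (η₀ / 2)) ε' / (8 * K * (1 + C)), by positivity, ?_⟩
    have e0 : 8 * K * (min (min (ε / 4) (η₀ / 2)) ε' / (8 * K * (1 + C))) * (1 + C) =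
      min (min (ε / 4) (η₀ / 2)) ε' := by field_simp
    set d := min (min (ε / 4) (η₀ / 2)) ε' / (8 * K * (1 + C)) with hd
    have hd0 : 0 < d := by positivity
    have a2 : min (min (ε / 4) (η₀ / 2)) (ε' : ℝ) ≤ ε' := min_le_right _ _
    have a3 : min (min (ε / 4) (η₀ / 2)) (ε' : ℝ) ≤ ε / 4 :=
      (min_le_left _ _).trans (min_le_left _ _)
    have a4 : min (min (ε / 4) (η₀ / 2)) (ε' : ℝ) ≤ η₀ / 2 :=
      (min_le_left _ _).trans (min_le_right _ _)
    have a5 : 0 ≤ K * d * C := by positivity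
    have a6 : 0 ≤ K * d := by positivity
    refine ⟨?_, ?_, ?_⟩ <;> nlinarith
  obtain ⟨δ, hδ, hδδ₀, hG⟩ := exists_regularTimes_small hac hT.le hφo hδ₀
  obtain ⟨η₁, hη₁, hosc⟩ := exists_setIntegral_speed_lt hac hT.le (half_pos hδ)
  obtain ⟨m, hm⟩ := exists_nat_gt (T / min η₁ (η₀ / 2))
  have hmin : 0 < min η₁ (η₀ / 2) := by positivity
  have hm0 : (0 : ℝ) < m := lt_of_le_of_lt (by positivity) hm
  have hTm : T / m < min η₁ (η₀ / 2) := by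
    rw [div_lt_iff₀ hm0]
    rw [div_lt_iff₀ hmin] at hm
    linarith
  have hmul : (m : ℝ) * (T / m) = T := by field_simp
  set G := ∫ t in Icc 0 T \ regularTimes T φ δ, speed φ t with hGdef
  have hG0 : 0 ≤ G := integral_nonneg fun t => zero_le_one.trans (one_le_speed t)
  have hKG : K * G ≤ K * δ₀ := by gcongr
  have hmod' : ∀ s ∈ Icc 0 T, ∀ t ∈ Icc 0 T, |s - t| ≤ T / m + 8 * K * G → ‖φ s - φ t‖ ≤ ε / 4 := by
    intro s hs t ht hst
    rw [← dist_eq_norm]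
    refine (hmod s hs t ht ?_).le
    rw [Real.dist_eq]
    linarith [hTm.trans_le (min_le_right _ _)]
  obtain ⟨ψ, σ, h1, h2, h3, h4, h5, h6⟩ := exists_plPath_approx hdense hconv hA1 hA3 hK hφo hac hδ
    (η := T / m) (e := ε / 4) (by positivity) (fun a ha haT => (hosc a _ ha
      (by have : 0 ≤ T / m := by positivity
          linarith) haT
      (by linarith [hTm.trans_le (min_le_left _ _)])).le) hmod' m hmul.le
  have hGle : ∫ t in Ioc 0 T \ regularTimes T φ δ, speed φ t ≤ G :=
    setIntegral_speed_mono ((integrableOn_speed hac hT.le).mono_set sdiff_subset)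
      (sdiff_subset_sdiff_left Ioc_subset_Icc_self).eventuallyLE
  have hKG' : K * (∫ t in Ioc 0 T \ regularTimes T φ δ, speed φ t) ≤ K * G := by gcongr
  rw [hmul] at h3 h4 h6
  rw [abs_le] at h4
  -- This exceeds the possible shortfall of `σ`, so the path with its rest reaches time `T`.
  set θ := 4 * K * δ₀ with hθ
  have hθ0 : 0 ≤ θ := by positivity
  have hTo : φ T ∈ orthant N := hφo T ⟨hT.le, le_rfl⟩
  have hconst : PLPath (fun _ => φ T) θ := .snoc 0 .zero hθ0 fun t _ => by simp
  have he : ψ σ = (fun _ : ℝ => φ T) 0 := h3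
  have hpl := (h1.append hconst he).restrict hT.le (by linarith [h4.1] : T ≤ σ + θ)
  have hP : ∀ t ∈ Icc 0 (σ + θ), append σ ψ (fun _ => φ T) t ∈ orthant N ∧
      (t ∈ Icc 0 T → ‖append σ ψ (fun _ => φ T) t - φ t‖ ≤ 2 * K * δ + ε / 4) := by
    refine append_mem he (P := fun t x => x ∈ orthant N ∧
      (t ∈ Icc 0 T → ‖x - φ t‖ ≤ 2 * K * δ + ε / 4)) h5 fun t ht => ⟨hTo, fun htT => ?_⟩
    have := hmod' T ⟨hT.le, le_rfl⟩ (σ + t) htT (by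
      have : 0 ≤ T / m := by positivity
      rw [abs_of_nonneg (by linarith [htT.2])]
      linarith [ht.1, h4.1, mul_nonneg (zero_le_one.trans hK1) hG0])
    have : 0 ≤ 2 * K * δ := by positivity
    linarith
  have hKδ : K * δ ≤ K * δ₀ := by gcongr
  refine (iInf₂_le (append σ ψ fun _ => φ T) ⟨isPiecewiseLinear_iff.2 ⟨fun t ht =>
    (hP t ⟨ht.1, by linarith [ht.2, h4.1]⟩).1, hpl⟩, skorohodDist_lt_of_forall_le (e := ε / 2) hε
      (by linarith) fun t ht => ((hP t ⟨ht.1, by linarith [ht.2, h4.1]⟩).2 ht).trans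
      (by linarith)⟩).trans ?_
  rw [action_eq_actionOn, action_eq_actionOn]
  refine (actionOn_mono (by linarith [h4.1] : T ≤ σ + θ) _).trans ?_
  rw [actionOn_append h1.nonneg hθ0 he]
  have hrest : actionOn L 0 θ (fun _ => φ T) ≤ ENNReal.ofReal (θ * C) := by
    rw [actionOn_linear (x := φ T) (v := 0) (Λ := posSet (φ T)) (fun t _ => by simp)
      (fun t _ => ⟨hTo, rfl⟩), sub_zero, ENNReal.ofReal_mul hθ0, ENNReal.ofReal_coe_nnreal, ← hC]
    gcongr
    exact cost_zero_le hdense hA1 hA3 _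
  calc _ ≤ actionOn L 0 T φ + ENNReal.ofReal θ + ENNReal.ofReal (θ * C) := by
        refine add_le_add (h6.trans ?_) hrest
        gcongr
        linarith
    _ = actionOn L 0 T φ + ENNReal.ofReal (θ * (1 + C)) := by
        rw [add_assoc, ← ENNReal.ofReal_add hθ0 (by positivity)]
        congr 2
        ring
    _ ≤ _ := by
        gcongr
        rw [← ENNReal.ofReal_coe_nnreal]
        exact ENNReal.ofReal_le_ofReal hδε'

end

end LocalLD

end

theorem theorem1 {N : ℕ} {Ω : Type*} [MeasurableSpace Ω] (M : LocalLD.MarkovFamily N Ω)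
    (hdense : M.DenseStates)
    (L : Set (Fin N) → LocalLD.Vec N → ℝ≥0∞)
    (hconv : ∀ Λ, ConvexOn ℝ≥0 Set.univ (L Λ))
    (hA1 : M.A1 L) (hA2 : LocalLD.A2 L) (hA3 : M.A3 L)
    (T : ℝ) (hT : 0 < T) (φ : ℝ → LocalLD.Vec N)
    (hφ : ∀ t ∈ Set.Icc 0 T, φ t ∈ LocalLD.orthant N)
    (hφ_ac : AbsolutelyContinuousOnInterval φ 0 T) :
    LocalLD.rateI L T φ = LocalLD.action L T φ ∧
      ((LocalLD.action L T φ : ℝ≥0∞) : EReal) = -M.W T φ ∧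
      ((LocalLD.action L T φ : ℝ≥0∞) : EReal) = -M.w T φ := by
  have huc := hφ_ac.uniformContinuousOn
  rw [uIcc_of_le hT.le] at huc
  have h1 := LocalLD.neg_rateI_le_w (hconv univ) hA1 hA2 hT hφ huc
  have h2 := LocalLD.MarkovFamily.w_le_W (T := T) hdense (hφ 0 ⟨le_rfl, hT.le⟩)
  have h3 := LocalLD.W_le_neg_action hdense hA1 hA3 hT hφ hφ_ac
  have h4 := LocalLD.rateI_le_action hdense hconv hA1 hA2 hA3 hT hφ hφ_ac
  have h5 : LocalLD.rateI L T φ = LocalLD.action L T φ := by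
    refine h4.antisymm ?_
    have := h1.trans (h2.trans h3)
    rw [EReal.neg_le_neg_iff] at this
    exact_mod_cast this
  rw [h5] at h1
  have hW := h3.antisymm (h1.trans h2)
  have hw := (h2.trans h3).antisymm h1
  refine ⟨h5, ?_, ?_⟩
  · rw [hW, neg_neg]
  · rw [hw, neg_neg]
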